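/- Setting. Let $m$ be Lebesgue measure on $[0,1]$ and $0<\alpha\le 1$. Let $T_a:[0,1]\to[0,1]$, $a\in[0,1]$, be a family of maps with partition points $0=b_0(a)<b_1(a)<\dots<b_p(a)=1$ ($p$ independent of $a$) such that: - on each interval $(b_{k-1}(a),b_k(a))$ the map $T_a$ is differentiable, $|T_a'(x)-T_a'(y)|\le C|x-y|^\alpha$ and $\lambda\le|T_a'|\le\Lambda$, with constants $C$ and $1<\lambda\le\Lambda<\infty$ independent of $a$ and $k$; - (i) each $a\mapsto b_k(a)$ is Lipschitz on $[0,1]$; - (ii) there is a constant $C$ such that for every $x\in[0,1]$ and every interval $J\subset[0,1]$ with $x\notin\{b_0(a),\dots,b_p(a)\}$ for all $a\in J$, the map $a\mapsto T_a(x)$ is differentiable on $J$, and $a\mapsto\partial_aT_a(x)$ and $a\mapsto T_a'(x)$ are $\alpha$-Hölder on $J$ with constant $C$; moreover $x\mapsto\partial_aT_a(x)$ is $\alpha$-Hölder on each $(b_{k-1}(a),b_k(a))$, uniformly in $a$ and $k$; - each $T_a$ has a unique absolutely continuous invariant probability measure $\mu_a$; put $K(a)=\operatorname{supp}\mu_a$;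 - (iii) the number of connected components of $K(a)\setminus\{b_0(a),\dots,b_p(a)\}$ is finite and independent of $a$, and, for a suitable labelling, their boundary points are $\alpha$-Hölder continuous in $a$. Fix $A>0$. For $\varphi\in L^1(m)$ let $\operatorname{osc}(\varphi,\delta,x)$ be the essential supremum minus the essential infimum of $\varphi$ on $(x-\delta,x+\delta)\cap[0,1]$, let $$|\varphi|_\alpha=\sup_{0<\delta\le A}\delta^{-\alpha}\int_0^1\operatorname{osc}(\varphi,\delta,x)\,dx,\qquad \|\varphi\|_\alpha=|\varphi|_\alpha+\|\varphi\|_{L^1},$$ and let $V_\alpha$ be the set of all (real) $\varphi\in L^1(m)$ with $|\varphi|_\alpha<\infty$. Let $\mathcal L_a\varphi(x)=\sum_{T_a(y)=x}\varphi(y)/|T_a'(y)|$ be the transfer operator. Assume condition (II) for some $0<\epsilon\le1$: - $T_0$ is topologically mixing on $K(0)$ (along orbits avoiding the partition points), i.e. for all open $U,V\subset\mathbb R$ meeting $K(0)$ there is $N$ such that for every $n\ge N$ there is $x\in U\cap K(0)$ with $T_0^i(x)\notin\{b_0(0),\dots,b_p(0)\}$ for $0\le i<n$ and $T_0^n(x)\in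 V\cap K(0)$; - there are $C\ge1$ and $0<\tilde\rho<1$ such that $\|\mathcal L_a^n\varphi\|_\alpha\le C\tilde\rho^n\|\varphi\|_\alpha+C\|\varphi\|_{L^1}$ for all $a\in[0,\epsilon]$, $\varphi\in V_\alpha$ and $n\ge1$. Proposition (uniform decay of correlations). There exist constants $0<\epsilon'\le\epsilon$, $C\ge1$ and $0<\rho<1$ such that for all $a\in[0,\epsilon']$, all $\varphi\in V_\alpha$, all $\psi\in L^1(m)$ and all $n\ge1$, the functions $\varphi\cdot\psi\circ T_a^n$ and $\psi$ are integrable with respect to $m$ and $\mu_a$ respectively, and $$\Big|\int_0^1\varphi\;\psi\circ T_a^n\,dm-\int_0^1\varphi\,dm\int_0^1\psi\,d\mu_a\Big|\le C\,\|\varphi\|_\alpha\,\|\psi\|_{L^1}\,\rho^n .$$ -/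

import Mathlib

open Set Filter Topology MeasureTheory
open scoped ENNReal NNReal

namespace UDC

/-- Lebesgue measure `m` on the unit interval. -/
noncomputable def leb : Measure ℝ := volume.restrict (Icc (0 : ℝ) 1)

/-- `ν` is an absolutely continuous invariant probability measure (acip) of `S : [0,1] → [0,1]`. -/
def IsAcip (S : ℝ → ℝ) (ν : Measure ℝ) : Prop :=
  IsProbabilityMeasure ν ∧ ν ≪ leb ∧ ν.map S = ν

/-- `∂_a T_a(x)` (one-sided at the two ends of the parameter interval `[0,1]`). -/
noncomputable def paramDeriv (T : ℝ → ℝ → ℝ) (a x : ℝ) : ℝ :=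
  derivWithin (fun a' => T a' x) (Icc 0 1) a

/-- The set `{b_0(a), …, b_p(a)}` of partition points. -/
def breakSet {p : ℕ} (b : Fin (p + 1) → ℝ → ℝ) (a : ℝ) : Set ℝ :=
  range fun k => b k a

/-- The connected components of a set of reals. -/
def components (S : Set ℝ) : Set (Set ℝ) :=
  {D | ∃ x ∈ S, D = connectedComponentIn S x}

/-- The model for one-parameter families `T_a : [0,1] → [0,1]`, `a ∈ [0,1]`, of uniformly
expanding, piecewise `C^{1+α}` maps with partition points `b_0(a) < … < b_p(a)` and unique
absolutely continuous invariant probability measures `μ_a`. Only the values `T a x` with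
`a, x ∈ [0,1]` matter. -/
structure IsExpandingFamily (α : ℝ) (T : ℝ → ℝ → ℝ) {p : ℕ} (b : Fin (p + 1) → ℝ → ℝ)
    (μ : ℝ → Measure ℝ) : Prop where
  mapsTo : ∀ a ∈ Icc (0 : ℝ) 1, MapsTo (T a) (Icc 0 1) (Icc 0 1)
  /-- `0 = b_0(a) < b_1(a) < … < b_p(a) = 1`. -/
  break_zero : ∀ a ∈ Icc (0 : ℝ) 1, b 0 a = 0
  break_last : ∀ a ∈ Icc (0 : ℝ) 1, b (Fin.last p) a = 1
  break_strictMono : ∀ a ∈ Icc (0 : ℝ) 1, StrictMono fun k => b k a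
  /-- `T_a` is differentiable on each `(b_{k-1}(a), b_k(a))`. -/
  differentiable : ∀ a ∈ Icc (0 : ℝ) 1, ∀ k : Fin p, ∀ x ∈ Ioo (b k.castSucc a) (b k.succ a),
    DifferentiableAt ℝ (T a) x
  /-- The derivative of `T_a` is `α`-Hölder on each `(b_{k-1}(a), b_k(a))`, uniformly in `a`. -/
  holder : ∃ C : ℝ, ∀ a ∈ Icc (0 : ℝ) 1, ∀ k : Fin p,
    ∀ x ∈ Ioo (b k.castSucc a) (b k.succ a), ∀ y ∈ Ioo (b k.castSucc a) (b k.succ a),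
      |deriv (T a) x - deriv (T a) y| ≤ C * |x - y| ^ α
  /-- Uniform expansion, and a uniform upper bound for the derivative. -/
  expanding : ∃ l u : ℝ, 1 < l ∧ l ≤ u ∧ ∀ a ∈ Icc (0 : ℝ) 1, ∀ k : Fin p,
    ∀ x ∈ Ioo (b k.castSucc a) (b k.succ a), l ≤ |deriv (T a) x| ∧ |deriv (T a) x| ≤ u
  /-- The partition points depend Lipschitz continuously on `a`. -/
  break_lipschitz : ∃ L : ℝ≥0, ∀ k, LipschitzOnWith L (b k) (Icc 0 1)
  /-- As long as `x` is not a partition point, `a ↦ T_a(x)` is `C^{1+α}` and `a ↦ ∂_x T_a(x)` is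
  `α`-Hölder, with constants independent of `x`. -/
  param_regular : ∃ C : ℝ, ∀ x ∈ Icc (0 : ℝ) 1, ∀ J : Set ℝ, J ⊆ Icc 0 1 → J.OrdConnected →
    (∀ a ∈ J, x ∉ breakSet b a) →
      (∀ a ∈ J, DifferentiableWithinAt ℝ (fun a' => T a' x) (Icc 0 1) a) ∧
      ∀ a ∈ J, ∀ a' ∈ J,
        |paramDeriv T a x - paramDeriv T a' x| ≤ C * |a - a'| ^ α ∧
        |deriv (T a) x - deriv (T a') x| ≤ C * |a - a'| ^ α
  /-- `x ↦ ∂_a T_a(x)` is `α`-Hölder on each `(b_{k-1}(a), b_k(a))`, uniformly in `a`. -/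
  paramDeriv_holder : ∃ C : ℝ, ∀ a ∈ Icc (0 : ℝ) 1, ∀ k : Fin p,
    ∀ x ∈ Ioo (b k.castSucc a) (b k.succ a), ∀ y ∈ Ioo (b k.castSucc a) (b k.succ a),
      |paramDeriv T a x - paramDeriv T a y| ≤ C * |x - y| ^ α
  /-- `μ_a` is the unique acip of `T_a`. -/
  acip : ∀ a ∈ Icc (0 : ℝ) 1, IsAcip (T a) (μ a)
  acip_unique : ∀ a ∈ Icc (0 : ℝ) 1, ∀ ν, IsAcip (T a) ν → ν = μ a
  /-- The number of components `D_k(a)` of `supp μ_a` minus the partition points does not depend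
  on `a`, and their boundary points are `α`-Hölder continuous in `a`. -/
  support_components : ∃ (p₁ : ℕ) (D : Fin p₁ → ℝ → Set ℝ) (C : ℝ),
    (∀ a ∈ Icc (0 : ℝ) 1, (Function.Injective fun k => D k a) ∧
      (range fun k => D k a) = components ((μ a).support \ breakSet b a)) ∧
    ∀ k, ∀ a ∈ Icc (0 : ℝ) 1, ∀ a' ∈ Icc (0 : ℝ) 1,
      |sInf (D k a) - sInf (D k a')| ≤ C * |a - a'| ^ α ∧
      |sSup (D k a) - sSup (D k a')| ≤ C * |a - a'| ^ α

/-- `S` is topologically mixing on `K`. The map `S` is prescribed, and continuous, only off the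
finite set `B` of partition points, so the mixing is required along orbits that do not meet
`B`. -/
def TopMixingOn (S : ℝ → ℝ) (B K : Set ℝ) : Prop :=
  ∀ U V : Set ℝ, IsOpen U → IsOpen V → (U ∩ K).Nonempty → (V ∩ K).Nonempty →
    ∃ N : ℕ, ∀ n ≥ N, ∃ x ∈ U ∩ K, (∀ i < n, S^[i] x ∉ B) ∧ S^[n] x ∈ V ∩ K

/-- The Perron–Frobenius transfer operator `φ ↦ ∑_{S(y) = x} φ(y) / |S'(y)|` of a piecewise
monotone map `S : [0,1] → [0,1]`, for which all these sums are finite. (The values of `S'` at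
partition points only influence the result on a null set.) -/
noncomputable def transfer (S : ℝ → ℝ) (φ : ℝ → ℝ) (x : ℝ) : ℝ :=
  ∑ᶠ y ∈ {y | y ∈ Icc (0 : ℝ) 1 ∧ S y = x}, φ y / |deriv S y|

/-- `osc(φ, δ, x)`: essential supremum minus essential infimum of `φ` on
`(x - δ, x + δ) ∩ [0,1]`, a value in `[0, ∞]`. -/
noncomputable def osc (φ : ℝ → ℝ) (δ x : ℝ) : ℝ≥0∞ :=
  (essSup (fun y => (φ y : EReal)) (leb.restrict (Ioo (x - δ) (x + δ))) -
    essInf (fun y => (φ y : EReal)) (leb.restrict (Ioo (x - δ) (x + δ)))).toENNReal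

/-- The seminorm `|φ|_α = sup_{0 < δ ≤ A} δ^{-α} ∫_0^1 osc(φ, δ, x) dx`, in `[0, ∞]`. -/
noncomputable def vSeminorm (α A : ℝ) (φ : ℝ → ℝ) : ℝ≥0∞ :=
  ⨆ δ ∈ Ioc (0 : ℝ) A, (∫⁻ x, osc φ δ x ∂leb) / ENNReal.ofReal (δ ^ α)

/-- The norm `‖φ‖_α = |φ|_α + ‖φ‖_{L¹}`, in `[0, ∞]`. -/
noncomputable def vNorm (α A : ℝ) (φ : ℝ → ℝ) : ℝ≥0∞ :=
  vSeminorm α A φ + eLpNorm φ 1 leb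

/-- `φ ∈ V_α`, the space of functions of generalised bounded variation. -/
def MemV (α A : ℝ) (φ : ℝ → ℝ) : Prop :=
  Integrable φ leb ∧ vSeminorm α A φ < ∞

/-- Condition (II), with `[0, ε]` the range of parameters: `T_0` is mixing, and the maps `T_a`,
`a ∈ [0, ε]`, satisfy a Lasota–Yorke inequality with uniform constants. -/
def ConditionII (α A : ℝ) (T : ℝ → ℝ → ℝ) {p : ℕ} (b : Fin (p + 1) → ℝ → ℝ)
    (μ : ℝ → Measure ℝ) (ε : ℝ) : Prop :=
  TopMixingOn (T 0) (breakSet b 0) (μ 0).support ∧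
  ∃ C r : ℝ, 1 ≤ C ∧ 0 < r ∧ r < 1 ∧
    ∀ a ∈ Icc (0 : ℝ) ε, ∀ φ : ℝ → ℝ, MemV α A φ → ∀ n : ℕ, 1 ≤ n →
      vNorm α A ((transfer (T a))^[n] φ) ≤
        ENNReal.ofReal (C * r ^ n) * vNorm α A φ + ENNReal.ofReal C * eLpNorm φ 1 leb

end UDC

/-!
# Uniform decay of correlations for small parameters

Write `P_a` for the transfer operator of `T_a`. Everything follows from one contraction: for a fixed
`Q` and all small `a`, `P_a^Q` halves the norm of `V_α` on the functions of zero mean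
(`ConditionII.exists_contraction`). Spectral theory is avoided; the contraction comes from the
uniform Lasota–Yorke inequality once `‖P_a^N φ‖_{L¹} ≤ η ‖φ‖_α` is known for zero mean functions
`φ`, a suitable `N` and a small `η`. This `L¹` bound is proved for `a = 0` and carried over to
small `a`.

* For `a = 0` (`HasLasotaYorke.exists_uniform_lOne_le`). Bounded sets of `V_α` are relatively
  compact in `L¹`, so it suffices that `P_0^n f → 0` in `L¹` for each `f` of zero mean. The orbit
  of `f` accumulates in `V_α` at a recurrent function `g` whose `L¹` norm is preserved by `P_0`, so
  that the images of its positive and negative parts never cancel. Uniqueness of the acip forces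
  both parts to charge its support unless `g = 0`, functions in `V_α` are bounded below on open
  sets where they are positive, and mixing then transports positive mass to a place where `g`, and
  hence `P_0^k g` at a large return time `k`, is negative. This contradiction shows `g = 0`
  (`IsRecurrent.lOne_eq_zero`).
* For small `a` (`IsExpandingFamily.eventually_lOne_sub_le`). The `L¹` norm of a function is, up to
  a small multiple of its norm in `V_α`, controlled by its integrals over finitely many intervals
  (`MemV.lOne_le_sum`), and by duality these vary little because `T_a^N → T_0^N` almost everywhere.

The Cesàro means of `P_a^k 1` yield an invariant density `w_a ∈ V_α`, which is the density of `μ_a`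
by uniqueness. As `V_α` embeds into `L^∞` (`exists_ae_abs_le_gbv`), the contraction applied to
`φ - (∫ φ) w_a` gives a uniform bound for `P_a^n φ - (∫ φ) w_a`, which is integrated against
`ψ ∈ L¹` (`HasLasotaYorke.decay_of_correlations`).
-/

namespace UDC

/-! ### Oscillation and the space of functions of generalised bounded variation -/

instance : IsProbabilityMeasure leb :=
  ⟨by simp [leb]⟩

/-- Almost all pairs of values differ by at most the oscillation. -/
theorem ae_ae_abs_le_osc (φ : ℝ → ℝ) (δ x : ℝ) :
    ∀ᵐ y ∂leb.restrict (Ioo (x - δ) (x + δ)), ∀ᵐ z ∂leb.restrict (Ioo (x - δ) (x + δ)),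
      ENNReal.ofReal |φ y - φ z| ≤ osc φ δ x := by
  have key : ∀ y z : ℝ,
      (φ y : EReal) ≤ essSup (fun y => (φ y : EReal)) (leb.restrict (Ioo (x - δ) (x + δ))) →
      essInf (fun y => (φ y : EReal)) (leb.restrict (Ioo (x - δ) (x + δ))) ≤ φ z →
      ENNReal.ofReal (φ y - φ z) ≤ osc φ δ x := by
    intro y z hy hz
    rw [← EReal.real_coe_toENNReal, EReal.coe_sub]
    exact EReal.toENNReal_le_toENNReal (EReal.sub_le_sub hy hz)
  have hs := ae_le_essSup (μ := leb.restrict (Ioo (x - δ) (x + δ)))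
    (f := fun y => (φ y : EReal))
  have hi := ae_essInf_le (μ := leb.restrict (Ioo (x - δ) (x + δ)))
    (f := fun y => (φ y : EReal))
  filter_upwards [hs, hi] with y hy hy'
  filter_upwards [hs, hi] with z hz hz'
  rcases abs_cases (φ y - φ z) with ⟨h, -⟩ | ⟨h, -⟩
  · rw [h]
    exact key y z hy hz'
  · rw [h, neg_sub]
    exact key z y hz hy'

theorem ae_ae_le_osc (φ : ℝ → ℝ) (δ x : ℝ) :
    ∀ᵐ y ∂leb.restrict (Ioo (x - δ) (x + δ)), ∀ᵐ z ∂leb.restrict (Ioo (x - δ) (x + δ)),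
      ENNReal.ofReal (φ y - φ z) ≤ osc φ δ x := by
  filter_upwards [ae_ae_abs_le_osc φ δ x] with y hy
  filter_upwards [hy] with z hz
  exact (ENNReal.ofReal_le_ofReal (le_abs_self _)).trans hz

/-- The oscillation as the best bound for the increments of almost all pairs of values. All
properties of `osc` are derived from this description, which involves no arithmetic in `EReal`. -/
theorem osc_le_iff {φ : ℝ → ℝ} {δ x : ℝ} {c : ℝ≥0∞} :
    osc φ δ x ≤ c ↔ ∀ᵐ y ∂leb.restrict (Ioo (x - δ) (x + δ)),
      ∀ᵐ z ∂leb.restrict (Ioo (x - δ) (x + δ)), ENNReal.ofReal (φ y - φ z) ≤ c := by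
  constructor
  · intro h
    filter_upwards [ae_ae_le_osc φ δ x] with y hy
    filter_upwards [hy] with z hz
    exact hz.trans h
  · intro h
    induction c using ENNReal.recTopCoe with
    | top => exact le_top
    | coe c =>
      rw [← EReal.toENNReal_coe (x := (c : ℝ≥0∞))]
      refine EReal.toENNReal_le_toENNReal (EReal.sub_le_of_le_add (essSup_le_of_ae_le _ ?_))
      filter_upwards [h] with y hy
      have h2 : ((φ y - c : ℝ) : EReal) ≤
          essInf (fun y => (φ y : EReal)) (leb.restrict (Ioo (x - δ) (x + δ))) := by
        refine le_essInf_of_ae_le _ ?_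
        filter_upwards [hy] with z hz
        rw [EReal.coe_le_coe_iff]
        have := (ENNReal.ofReal_le_iff_le_toReal ENNReal.coe_ne_top).1 hz
        simp only [ENNReal.coe_toReal] at this
        linarith
      calc (φ y : EReal) = (c : ℝ) + ((φ y - c : ℝ) : EReal) := by
            rw [← EReal.coe_add]; congr 1; ring
        _ ≤ _ := by
            refine add_le_add (le_of_eq ?_) h2
            rfl

theorem osc_congr {φ ψ : ℝ → ℝ} (h : φ =ᵐ[leb] ψ) (δ x : ℝ) : osc φ δ x = osc ψ δ x := by
  have h' : (fun y => (φ y : EReal)) =ᵐ[leb.restrict (Ioo (x - δ) (x + δ))]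
      fun y => (ψ y : EReal) := by
    filter_upwards [ae_restrict_of_ae h] with y hy
    rw [hy]
  rw [osc, osc, essSup_congr_ae h', essInf_congr_ae h']

theorem osc_add_le (φ ψ : ℝ → ℝ) (δ x : ℝ) :
    osc (fun y => φ y + ψ y) δ x ≤ osc φ δ x + osc ψ δ x := by
  rw [osc_le_iff]
  filter_upwards [ae_ae_le_osc φ δ x, ae_ae_le_osc ψ δ x] with y h1 h2
  filter_upwards [h1, h2] with z h3 h4
  refine le_trans ?_ (add_le_add h3 h4)
  refine le_trans (ENNReal.ofReal_le_ofReal ?_) ENNReal.ofReal_add_le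
  linarith

/-- The oscillation of `ψ` is at most that of `φ` if `ψ` is a Lipschitz function of `φ` with
constant `1`. -/
theorem osc_le_of_abs_sub_le {φ ψ : ℝ → ℝ} (h : ∀ y z, |ψ y - ψ z| ≤ |φ y - φ z|) (δ x : ℝ) :
    osc ψ δ x ≤ osc φ δ x := by
  rw [osc_le_iff]
  filter_upwards [ae_ae_abs_le_osc φ δ x] with y hy
  filter_upwards [hy] with z hz
  exact (ENNReal.ofReal_le_ofReal ((le_abs_self _).trans (h y z))).trans hz

theorem osc_const_mul_le (c : ℝ) (φ : ℝ → ℝ) (δ x : ℝ) :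
    osc (fun y => c * φ y) δ x ≤ ENNReal.ofReal |c| * osc φ δ x := by
  rw [osc_le_iff]
  filter_upwards [ae_ae_abs_le_osc φ δ x] with y hy
  filter_upwards [hy] with z hz
  calc ENNReal.ofReal (c * φ y - c * φ z) ≤ ENNReal.ofReal (|c| * |φ y - φ z|) := by
        rw [← mul_sub, ← abs_mul]
        exact ENNReal.ofReal_le_ofReal (le_abs_self _)
    _ = ENNReal.ofReal |c| * ENNReal.ofReal |φ y - φ z| := ENNReal.ofReal_mul (abs_nonneg _)
    _ ≤ _ := by gcongr

theorem osc_const (c δ x : ℝ) : osc (fun _ => c) δ x = 0 := by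
  rw [← nonpos_iff_eq_zero, osc_le_iff]
  simp

/-- `x ↦ osc φ δ x` is lower semicontinuous because the intervals are open: a pair of points in
the interval around `x` lies in the interval around every nearby point. -/
theorem lowerSemicontinuous_osc (φ : ℝ → ℝ) (δ : ℝ) : LowerSemicontinuous (osc φ δ) := by
  rw [lowerSemicontinuous_iff_isClosed_preimage]
  intro c
  refine isClosed_of_closure_subset fun x hx => ?_
  obtain ⟨u, hu, hux⟩ := mem_closure_iff_seq_limit.1 hx
  have hu' : ∀ᵐ y ∂leb, ∀ n, y ∈ Ioo (u n - δ) (u n + δ) →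
      ∀ᵐ z ∂leb, z ∈ Ioo (u n - δ) (u n + δ) → ENNReal.ofReal (φ y - φ z) ≤ c := by
    rw [ae_all_iff]
    intro n
    have := osc_le_iff.1 (hu n)
    rw [ae_restrict_iff' measurableSet_Ioo] at this
    filter_upwards [this] with y hy hyn
    exact (ae_restrict_iff' measurableSet_Ioo).1 (hy hyn)
  have hev : ∀ y ∈ Ioo (x - δ) (x + δ), ∀ᶠ n in atTop, y ∈ Ioo (u n - δ) (u n + δ) := by
    intro y hy
    have h1 : ∀ᶠ n in atTop, u n < y + δ := hux.eventually_lt_const (by linarith [hy.1])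
    have h2 : ∀ᶠ n in atTop, y - δ < u n := hux.eventually_const_lt (by linarith [hy.2])
    filter_upwards [h1, h2] with n h3 h4
    exact ⟨by linarith, by linarith⟩
  refine osc_le_iff.2 ((ae_restrict_iff' measurableSet_Ioo).2 ?_)
  filter_upwards [hu'] with y hy hyx
  rw [ae_restrict_iff' measurableSet_Ioo]
  have : ∀ᵐ z ∂leb, ∀ n, y ∈ Ioo (u n - δ) (u n + δ) → z ∈ Ioo (u n - δ) (u n + δ) →
      ENNReal.ofReal (φ y - φ z) ≤ c := by
    rw [ae_all_iff]
    intro n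
    by_cases hyn : y ∈ Ioo (u n - δ) (u n + δ)
    · filter_upwards [hy n hyn] with z hz _
      exact hz
    · exact Eventually.of_forall fun z h => absurd h hyn
  filter_upwards [this] with z hz hzx
  obtain ⟨n, h1, h2⟩ := ((hev y hyx).and (hev z hzx)).exists
  exact hz n h1 h2

theorem measurable_osc (φ : ℝ → ℝ) (δ : ℝ) : Measurable (osc φ δ) :=
  (lowerSemicontinuous_osc φ δ).measurable

theorem osc_le_liminf {φ : ℝ → ℝ} {f : ℕ → ℝ → ℝ}
    (h : ∀ᵐ x ∂leb, Tendsto (fun n => f n x) atTop (𝓝 (φ x))) (δ x : ℝ) :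
    osc φ δ x ≤ liminf (fun n => osc (f n) δ x) atTop := by
  rw [osc_le_iff]
  have h' := ae_restrict_of_ae (s := Ioo (x - δ) (x + δ)) h
  filter_upwards [h', ae_all_iff.2 fun n => ae_ae_le_osc (f n) δ x] with y hy hy'
  filter_upwards [h', ae_all_iff.2 hy'] with z hz hz'
  rw [← (ENNReal.tendsto_ofReal (hy.sub hz)).liminf_eq]
  exact liminf_le_liminf (Eventually.of_forall hz')

theorem vSeminorm_le_iff {α A : ℝ} {φ : ℝ → ℝ} {c : ℝ≥0∞} :
    vSeminorm α A φ ≤ c ↔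
      ∀ δ ∈ Ioc (0 : ℝ) A, ∫⁻ x, osc φ δ x ∂leb ≤ c * ENNReal.ofReal (δ ^ α) := by
  simp only [vSeminorm, iSup_le_iff]
  refine forall₂_congr fun δ hδ => ?_
  rw [ENNReal.div_le_iff]
  · simpa using Real.rpow_pos_of_pos hδ.1 α
  · exact ENNReal.ofReal_ne_top

theorem lintegral_osc_le {α A δ : ℝ} (φ : ℝ → ℝ) (hδ : δ ∈ Ioc (0 : ℝ) A) :
    ∫⁻ x, osc φ δ x ∂leb ≤ vSeminorm α A φ * ENNReal.ofReal (δ ^ α) :=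
  vSeminorm_le_iff.1 le_rfl δ hδ

theorem vSeminorm_mono {α A : ℝ} {φ ψ : ℝ → ℝ} (h : ∀ δ x, osc ψ δ x ≤ osc φ δ x) :
    vSeminorm α A ψ ≤ vSeminorm α A φ :=
  vSeminorm_le_iff.2 fun δ hδ => (lintegral_mono (h δ)).trans (lintegral_osc_le φ hδ)

theorem vSeminorm_congr {α A : ℝ} {φ ψ : ℝ → ℝ} (h : φ =ᵐ[leb] ψ) :
    vSeminorm α A φ = vSeminorm α A ψ :=
  le_antisymm (vSeminorm_mono fun δ x => (osc_congr h δ x).le)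
    (vSeminorm_mono fun δ x => (osc_congr h δ x).ge)

theorem vSeminorm_add_le (α A : ℝ) (φ ψ : ℝ → ℝ) :
    vSeminorm α A (fun x => φ x + ψ x) ≤ vSeminorm α A φ + vSeminorm α A ψ := by
  refine vSeminorm_le_iff.2 fun δ hδ => ?_
  calc ∫⁻ x, osc (fun y => φ y + ψ y) δ x ∂leb ≤ ∫⁻ x, osc φ δ x + osc ψ δ x ∂leb :=
        lintegral_mono (osc_add_le φ ψ δ)
    _ = ∫⁻ x, osc φ δ x ∂leb + ∫⁻ x, osc ψ δ x ∂leb :=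
        lintegral_add_left (measurable_osc φ δ) _
    _ ≤ _ := by
        rw [add_mul]
        exact add_le_add (lintegral_osc_le φ hδ) (lintegral_osc_le ψ hδ)

theorem vSeminorm_const_mul_le (α A c : ℝ) (φ : ℝ → ℝ) :
    vSeminorm α A (fun x => c * φ x) ≤ ENNReal.ofReal |c| * vSeminorm α A φ := by
  refine vSeminorm_le_iff.2 fun δ hδ => ?_
  calc ∫⁻ x, osc (fun y => c * φ y) δ x ∂leb ≤ ∫⁻ x, ENNReal.ofReal |c| * osc φ δ x ∂leb :=
        lintegral_mono (osc_const_mul_le c φ δ)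
    _ = ENNReal.ofReal |c| * ∫⁻ x, osc φ δ x ∂leb :=
        lintegral_const_mul _ (measurable_osc φ δ)
    _ ≤ _ := by
        rw [mul_assoc]
        gcongr
        exact lintegral_osc_le φ hδ

theorem vSeminorm_const (α A c : ℝ) : vSeminorm α A (fun _ => c) = 0 := by
  rw [← nonpos_iff_eq_zero, vSeminorm_le_iff]
  intro δ _
  simp [osc_const]

/-- Lower semicontinuity of the seminorm (Fatou). -/
theorem vSeminorm_le_of_tendsto_ae {α A : ℝ} {φ : ℝ → ℝ} {f : ℕ → ℝ → ℝ} {c : ℝ≥0∞}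
    (h : ∀ᵐ x ∂leb, Tendsto (fun n => f n x) atTop (𝓝 (φ x)))
    (hf : ∀ n, vSeminorm α A (f n) ≤ c) : vSeminorm α A φ ≤ c := by
  refine vSeminorm_le_iff.2 fun δ hδ => ?_
  calc ∫⁻ x, osc φ δ x ∂leb ≤ ∫⁻ x, liminf (fun n => osc (f n) δ x) atTop ∂leb :=
        lintegral_mono (osc_le_liminf h δ)
    _ ≤ liminf (fun n => ∫⁻ x, osc (f n) δ x ∂leb) atTop :=
        lintegral_liminf_le fun n => measurable_osc (f n) δ
    _ ≤ liminf (fun _ : ℕ => c * ENNReal.ofReal (δ ^ α)) atTop :=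
        liminf_le_liminf (Eventually.of_forall fun n => vSeminorm_le_iff.1 (hf n) δ hδ)
    _ = _ := by simp

/-! ### The real-valued norms -/

/-- The `L¹` norm with respect to `m`, as a real number (junk if `φ` is not integrable). -/
noncomputable def lOne (φ : ℝ → ℝ) : ℝ := ∫ x, |φ x| ∂leb

/-- The norm of `V_α` as a real number (junk if `φ ∉ V_α`). -/
noncomputable def gbv (α A : ℝ) (φ : ℝ → ℝ) : ℝ := (vNorm α A φ).toReal

theorem eLpNorm_eq_ofReal_lOne {φ : ℝ → ℝ} (h : Integrable φ leb) :
    eLpNorm φ 1 leb = ENNReal.ofReal (lOne φ) := by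
  rw [eLpNorm_one_eq_lintegral_enorm, lOne, ← ofReal_integral_norm_eq_lintegral_enorm h]
  simp only [Real.norm_eq_abs]

theorem lOne_nonneg (φ : ℝ → ℝ) : 0 ≤ lOne φ := integral_nonneg fun _ => abs_nonneg _

theorem lOne_add_le {φ ψ : ℝ → ℝ} (h : Integrable φ leb) (h' : Integrable ψ leb) :
    lOne (fun x => φ x + ψ x) ≤ lOne φ + lOne ψ := by
  rw [lOne, lOne, lOne, ← integral_add h.abs h'.abs]
  exact integral_mono (h.add h').abs (h.abs.add h'.abs) fun x => abs_add_le _ _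

theorem lOne_sub_le {φ ψ χ : ℝ → ℝ} (h : Integrable φ leb) (h' : Integrable ψ leb)
    (h'' : Integrable χ leb) :
    lOne (fun x => φ x - χ x) ≤ lOne (fun x => φ x - ψ x) + lOne (fun x => ψ x - χ x) := by
  refine le_trans (le_of_eq ?_) (lOne_add_le (h.sub h') (h'.sub h''))
  congr 1
  ext x
  simp

theorem lOne_sub_comm (φ ψ : ℝ → ℝ) : lOne (fun x => φ x - ψ x) = lOne fun x => ψ x - φ x := by
  simp only [lOne, abs_sub_comm]

theorem abs_integral_le_lOne (φ : ℝ → ℝ) : |∫ x, φ x ∂leb| ≤ lOne φ :=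
  abs_integral_le_integral_abs

theorem abs_lOne_sub_lOne_le {φ ψ : ℝ → ℝ} (h : Integrable φ leb) (h' : Integrable ψ leb) :
    |lOne φ - lOne ψ| ≤ lOne fun x => φ x - ψ x := by
  rw [lOne, lOne, ← integral_sub h.abs h'.abs]
  refine (abs_integral_le_lOne _).trans ?_
  exact integral_mono (h.abs.sub h'.abs).abs (h.sub h').abs fun x => abs_abs_sub_abs_le _ _

namespace MemV

variable {α A : ℝ} {φ ψ : ℝ → ℝ}

theorem congr (h : MemV α A φ) (e : φ =ᵐ[leb] ψ) : MemV α A ψ :=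
  ⟨h.1.congr e, vSeminorm_congr (α := α) (A := A) e ▸ h.2⟩

theorem add (h : MemV α A φ) (h' : MemV α A ψ) : MemV α A fun x => φ x + ψ x :=
  ⟨h.1.add h'.1, (vSeminorm_add_le α A φ ψ).trans_lt (ENNReal.add_lt_top.2 ⟨h.2, h'.2⟩)⟩

theorem const_mul (h : MemV α A φ) (c : ℝ) : MemV α A fun x => c * φ x :=
  ⟨h.1.const_mul c, (vSeminorm_const_mul_le α A c φ).trans_lt
    (ENNReal.mul_lt_top ENNReal.ofReal_lt_top h.2)⟩

theorem sub (h : MemV α A φ) (h' : MemV α A ψ) : MemV α A fun x => φ x - ψ x := by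
  have := h.add (h'.const_mul (-1))
  simpa [sub_eq_add_neg] using this

protected theorem const (α A c : ℝ) : MemV α A fun _ => c :=
  ⟨integrable_const c, by simp [vSeminorm_const]⟩

theorem vNorm_eq (h : MemV α A φ) : vNorm α A φ = ENNReal.ofReal (gbv α A φ) := by
  rw [gbv, ENNReal.ofReal_toReal]
  rw [vNorm, eLpNorm_eq_ofReal_lOne h.1]
  exact ENNReal.add_ne_top.2 ⟨h.2.ne, ENNReal.ofReal_ne_top⟩

theorem gbv_eq (h : MemV α A φ) : gbv α A φ = (vSeminorm α A φ).toReal + lOne φ := by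
  rw [gbv, vNorm, eLpNorm_eq_ofReal_lOne h.1, ENNReal.toReal_add h.2.ne ENNReal.ofReal_ne_top,
    ENNReal.toReal_ofReal (lOne_nonneg φ)]

theorem lOne_le (h : MemV α A φ) : lOne φ ≤ gbv α A φ := by
  rw [h.gbv_eq]
  linarith [ENNReal.toReal_nonneg (a := vSeminorm α A φ)]

theorem gbv_add_le (h : MemV α A φ) (h' : MemV α A ψ) :
    gbv α A (fun x => φ x + ψ x) ≤ gbv α A φ + gbv α A ψ := by
  rw [(h.add h').gbv_eq, h.gbv_eq, h'.gbv_eq]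
  have h1 := lOne_add_le h.1 h'.1
  have h2 := ENNReal.toReal_mono (ENNReal.add_ne_top.2 ⟨h.2.ne, h'.2.ne⟩)
    (vSeminorm_add_le α A φ ψ)
  rw [ENNReal.toReal_add h.2.ne h'.2.ne] at h2
  linarith

theorem gbv_const_mul_le (h : MemV α A φ) (c : ℝ) :
    gbv α A (fun x => c * φ x) ≤ |c| * gbv α A φ := by
  rw [(h.const_mul c).gbv_eq, h.gbv_eq]
  have h1 : lOne (fun x => c * φ x) = |c| * lOne φ := by
    simp only [lOne, abs_mul]
    exact integral_const_mul _ _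
  have h2 := ENNReal.toReal_mono (ENNReal.mul_ne_top ENNReal.ofReal_ne_top h.2.ne)
    (vSeminorm_const_mul_le α A c φ)
  rw [ENNReal.toReal_mul, ENNReal.toReal_ofReal (abs_nonneg c)] at h2
  rw [h1, mul_add]
  linarith

theorem gbv_sub_le (h : MemV α A φ) (h' : MemV α A ψ) :
    gbv α A (fun x => φ x - ψ x) ≤ gbv α A φ + gbv α A ψ := by
  have h1 := h.gbv_add_le (h'.const_mul (-1))
  have h2 := h'.gbv_const_mul_le (-1)
  simp only [neg_mul, one_mul, abs_neg, abs_one, ← sub_eq_add_neg] at h1 h2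
  linarith

theorem of_abs_sub_le (h : MemV α A φ) (hψ : AEStronglyMeasurable ψ leb)
    (hb : ∀ y, |ψ y| ≤ |φ y|) (hd : ∀ y z, |ψ y - ψ z| ≤ |φ y - φ z|) : MemV α A ψ :=
  ⟨h.1.mono hψ (Eventually.of_forall hb),
    (vSeminorm_mono (osc_le_of_abs_sub_le hd)).trans_lt h.2⟩

theorem abs (h : MemV α A φ) : MemV α A fun x => |φ x| :=
  h.of_abs_sub_le h.1.abs.1 (fun y => by simp) fun y z => abs_abs_sub_abs_le _ _

theorem pos_part (h : MemV α A φ) : MemV α A fun x => max (φ x) 0 :=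
  h.of_abs_sub_le h.1.pos_part.1 (fun y => by
    rw [abs_of_nonneg (le_max_right _ _)]
    exact max_le (le_abs_self _) (abs_nonneg _)) fun y z => abs_max_sub_max_le_abs _ _ _

end MemV

theorem gbv_nonneg (α A : ℝ) (φ : ℝ → ℝ) : 0 ≤ gbv α A φ := ENNReal.toReal_nonneg

theorem gbv_congr {α A : ℝ} {φ ψ : ℝ → ℝ} (h : φ =ᵐ[leb] ψ) : gbv α A φ = gbv α A ψ := by
  rw [gbv, gbv, vNorm, vNorm, vSeminorm_congr h, eLpNorm_congr_ae h]

theorem gbv_const (α A c : ℝ) : gbv α A (fun _ => c) = |c| := by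
  rw [(MemV.const α A c).gbv_eq, vSeminorm_const]
  simp [lOne]

/-! ### Partitions of the unit interval -/

/-- `β` lists the points `0 = β_0 < β_1 < … < β_p = 1` of a partition of `[0,1]`. -/
structure IsPartition {p : ℕ} (β : Fin (p + 1) → ℝ) : Prop where
  strictMono : StrictMono β
  zero : β 0 = 0
  last : β (Fin.last p) = 1

/-- The `k`-th open interval of the partition `β`. -/
def cell {p : ℕ} (β : Fin (p + 1) → ℝ) (k : Fin p) : Set ℝ := Ioo (β k.castSucc) (β k.succ)

theorem measurableSet_cell {p : ℕ} (β : Fin (p + 1) → ℝ) (k : Fin p) :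
    MeasurableSet (cell β k) := measurableSet_Ioo

theorem leb_eq_zero_of_finite {s : Set ℝ} (hs : s.Finite) : leb s = 0 :=
  Measure.absolutelyContinuous_of_le Measure.restrict_le_self (hs.measure_zero volume)

theorem ae_mem_Icc : ∀ᵐ x ∂leb, x ∈ Icc (0 : ℝ) 1 := ae_restrict_mem measurableSet_Icc

namespace IsPartition

variable {p : ℕ} {β : Fin (p + 1) → ℝ}

theorem cell_subset (h : IsPartition β) (k : Fin p) : cell β k ⊆ Icc 0 1 := by
  intro x hx
  have h0 : β 0 ≤ β k.castSucc := h.strictMono.monotone (Fin.zero_le _)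
  have h1 : β k.succ ≤ β (Fin.last p) := h.strictMono.monotone (Fin.le_last _)
  rw [h.zero] at h0
  rw [h.last] at h1
  exact ⟨h0.trans hx.1.le, hx.2.le.trans h1⟩

theorem leb_restrict_cell (h : IsPartition β) (k : Fin p) :
    leb.restrict (cell β k) = volume.restrict (cell β k) := by
  rw [leb, Measure.restrict_restrict_of_subset (h.cell_subset k)]

theorem exists_mem_cell (h : IsPartition β) {x : ℝ} (hx : x ∈ Icc (0 : ℝ) 1)
    (hxβ : x ∉ range β) : ∃ k, x ∈ cell β k := by
  by_contra hcon
  push Not at hcon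
  have key : ∀ i : Fin (p + 1), β i < x := by
    intro i
    induction i using Fin.induction with
    | zero =>
      rw [h.zero]
      exact lt_of_le_of_ne hx.1 fun e => hxβ ⟨0, by rw [h.zero, e]⟩
    | succ k ih =>
      by_contra hk
      refine hcon k ⟨ih, lt_of_le_of_ne (not_lt.1 hk) fun e => hxβ ⟨_, e.symm⟩⟩
  have := key (Fin.last p)
  rw [h.last] at this
  exact absurd hx.2 (not_le.2 this)

theorem disjoint_cell (h : IsPartition β) : Pairwise (Function.onFun Disjoint (cell β)) := by
  have key : ∀ i j : Fin p, i < j → Disjoint (cell β i) (cell β j) := by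
    intro i j hij
    refine Set.disjoint_left.2 fun x hi hj => ?_
    have : β i.succ ≤ β j.castSucc := h.strictMono.monotone (by
      rw [Fin.le_def]
      simpa using hij)
    exact absurd (hi.2.trans_le this) (not_lt.2 hj.1.le)
  intro i j hij
  rcases lt_or_gt_of_ne hij with h1 | h1
  · exact key i j h1
  · exact (key j i h1).symm

theorem ae_mem_iUnion (h : IsPartition β) : ∀ᵐ x ∂leb, x ∈ ⋃ k, cell β k := by
  have h0 : ∀ᵐ x ∂leb, x ∉ range β :=
    measure_eq_zero_iff_ae_notMem.1 (leb_eq_zero_of_finite (finite_range β))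
  filter_upwards [h0, ae_mem_Icc] with x hx hx1
  exact mem_iUnion.2 (h.exists_mem_cell hx1 hx)

theorem leb_eq_restrict (h : IsPartition β) : leb = volume.restrict (⋃ k, cell β k) := by
  conv_lhs => rw [← Measure.restrict_eq_self_of_ae_mem h.ae_mem_iUnion]
  rw [leb, Measure.restrict_restrict_of_subset (iUnion_subset h.cell_subset)]

theorem integrableOn_cell (h : IsPartition β) {f : ℝ → ℝ} (hf : Integrable f leb) (k : Fin p) :
    IntegrableOn f (cell β k) := by
  have := hf.integrableOn (s := cell β k)
  rwa [IntegrableOn, h.leb_restrict_cell] at this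

theorem integrable_iff (h : IsPartition β) {f : ℝ → ℝ} :
    Integrable f leb ↔ ∀ k, IntegrableOn f (cell β k) := by
  refine ⟨fun hf k => h.integrableOn_cell hf k, fun hf => ?_⟩
  rw [h.leb_eq_restrict]
  exact (integrableOn_finite_iUnion).2 hf

theorem integral_eq_sum (h : IsPartition β) {f : ℝ → ℝ} (hf : Integrable f leb) :
    ∫ x, f x ∂leb = ∑ k, ∫ x in cell β k, f x := by
  rw [h.leb_eq_restrict]
  exact integral_iUnion_fintype (measurableSet_cell β) h.disjoint_cell
    fun k => h.integrableOn_cell hf k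

theorem lintegral_eq_sum (h : IsPartition β) (f : ℝ → ℝ≥0∞) :
    ∫⁻ x, f x ∂leb = ∑ k, ∫⁻ x in cell β k, f x := by
  rw [h.leb_eq_restrict, lintegral_iUnion (measurableSet_cell β) h.disjoint_cell, tsum_fintype]

theorem ae_of_forall_cell (h : IsPartition β) {q : ℝ → Prop}
    (hq : ∀ k, ∀ᵐ x ∂volume.restrict (cell β k), q x) : ∀ᵐ x ∂leb, q x := by
  rw [h.leb_eq_restrict, ae_restrict_iUnion_iff]
  exact hq

end IsPartition

/-- The partition of `[0,1]` into `M` intervals of equal length. -/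
noncomputable def uniformPartition (M : ℕ) (i : Fin (M + 1)) : ℝ := (i : ℕ) / (M : ℝ)

theorem isPartition_uniformPartition {M : ℕ} (hM : 0 < M) : IsPartition (uniformPartition M) where
  strictMono i j hij := by
    have : ((i : ℕ) : ℝ) < (j : ℕ) := by exact_mod_cast hij
    have hM' : (0 : ℝ) < M := by exact_mod_cast hM
    simp only [uniformPartition]
    gcongr
  zero := by simp [uniformPartition]
  last := by
    have hM' : (M : ℝ) ≠ 0 := by exact_mod_cast hM.ne'
    simp [uniformPartition, hM']

theorem uniformPartition_succ_sub {M : ℕ} (k : Fin M) :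
    uniformPartition M k.succ - uniformPartition M k.castSucc = 1 / M := by
  simp only [uniformPartition, Fin.val_succ, Fin.val_castSucc]
  push_cast
  ring

/-! ### Sup bound and compactness -/

/-- On an interval of length at most `δ`, a function is close to its mean value: some point `x₀` of
the interval has at most average oscillation, and the interval is contained in
`(x₀ - δ, x₀ + δ)`. -/
theorem ae_abs_mul_le_of_length_le {φ : ℝ → ℝ} {s t δ : ℝ} (hs : 0 ≤ s) (hst : s < t) (ht : t ≤ 1)
    (hδ : t - s ≤ δ) (hφ : IntegrableOn φ (Ioo s t))
    (hosc : ∫⁻ x in Ioo s t, osc φ δ x ≠ ∞) :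
    ∀ᵐ y ∂volume.restrict (Ioo s t), |φ y| * (t - s) ≤
      |∫ x in Ioo s t, φ x| + (∫⁻ x in Ioo s t, osc φ δ x).toReal := by
  have hpos : 0 < t - s := sub_pos.2 hst
  obtain ⟨x₀, hx₀, hle⟩ := exists_le_setLAverage (μ := volume) (s := Ioo s t) (f := osc φ δ)
    (by simp [hst]) (by simp) (measurable_osc φ δ).aemeasurable
  rw [setLAverage_eq, Real.volume_Ioo] at hle
  have hfin : osc φ δ x₀ ≠ ∞ := ne_top_of_le_ne_top
    (ENNReal.div_ne_top hosc (by simp [hst])) hle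
  have hd : (osc φ δ x₀).toReal * (t - s) ≤ (∫⁻ x in Ioo s t, osc φ δ x).toReal := by
    have := ENNReal.toReal_mono hosc ((ENNReal.le_div_iff_mul_le (by simp [hst]) (by simp)).1 hle)
    rwa [ENNReal.toReal_mul, ENNReal.toReal_ofReal hpos.le] at this
  have hsub : Ioo s t ⊆ Ioo (x₀ - δ) (x₀ + δ) := fun y hy =>
    ⟨by linarith [hx₀.2, hy.1], by linarith [hx₀.1, hy.2]⟩
  have hrestr : leb.restrict (Ioo s t) = volume.restrict (Ioo s t) := by
    have : Ioo s t ⊆ Icc 0 1 := fun y hy => ⟨hs.trans hy.1.le, hy.2.le.trans ht⟩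
    rw [leb, Measure.restrict_restrict_of_subset this]
  have h1 := ae_restrict_of_ae_restrict_of_subset hsub (ae_ae_abs_le_osc φ δ x₀)
  rw [hrestr] at h1
  filter_upwards [h1] with y hy
  have h2 := ae_restrict_of_ae_restrict_of_subset hsub hy
  rw [hrestr] at h2
  have h3 : ∀ᵐ z ∂volume.restrict (Ioo s t), ‖φ y - φ z‖ ≤ (osc φ δ x₀).toReal := by
    filter_upwards [h2] with z hz
    exact (ENNReal.ofReal_le_iff_le_toReal hfin).1 hz
  have h4 := norm_integral_le_of_norm_le_const h3
  have hvol : (volume.restrict (Ioo s t)).real univ = t - s := by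
    simp [Measure.real, hpos.le]
  rw [integral_sub (integrable_const _) hφ, integral_const, hvol, smul_eq_mul, Real.norm_eq_abs]
    at h4
  have h5 : |φ y| * (t - s) = |(t - s) * φ y| := by
    rw [abs_mul, abs_of_pos hpos, mul_comm]
  rw [h5]
  calc |(t - s) * φ y| = |(∫ x in Ioo s t, φ x) + ((t - s) * φ y - ∫ x in Ioo s t, φ x)| := by
        congr 1; ring
    _ ≤ _ := (abs_add_le _ _).trans (by linarith)

theorem MemV.toReal_lintegral_osc_le {α A δ : ℝ} {φ : ℝ → ℝ} (h : MemV α A φ)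
    (hδ : δ ∈ Ioc (0 : ℝ) A) :
    (∫⁻ x, osc φ δ x ∂leb) ≠ ∞ ∧ (∫⁻ x, osc φ δ x ∂leb).toReal ≤ δ ^ α * gbv α A φ := by
  have h1 := lintegral_osc_le (α := α) φ hδ
  have h2 : vSeminorm α A φ * ENNReal.ofReal (δ ^ α) ≠ ∞ :=
    ENNReal.mul_ne_top h.2.ne ENNReal.ofReal_ne_top
  refine ⟨ne_top_of_le_ne_top h2 h1, (ENNReal.toReal_mono h2 h1).trans ?_⟩
  have h3 := Real.rpow_nonneg hδ.1.le α
  rw [ENNReal.toReal_mul, ENNReal.toReal_ofReal h3, mul_comm, h.gbv_eq]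
  exact mul_le_mul_of_nonneg_left (by linarith [lOne_nonneg φ]) h3

theorem MemV.ae_cell_abs_div_le {α A : ℝ} {φ : ℝ → ℝ} (h : MemV α A φ) {M : ℕ} (hM : 0 < M)
    (hMA : 1 / (M : ℝ) ≤ A) (k : Fin M) :
    ∀ᵐ y ∂volume.restrict (cell (uniformPartition M) k), |φ y| * (1 / M) ≤
      |∫ x in cell (uniformPartition M) k, φ x| +
        (∫⁻ x in cell (uniformPartition M) k, osc φ (1 / M) x).toReal := by
  have hP := isPartition_uniformPartition hM
  have hM' : (0 : ℝ) < M := by exact_mod_cast hM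
  have hlt : uniformPartition M k.castSucc < uniformPartition M k.succ :=
    hP.strictMono Fin.castSucc_lt_succ
  have h0 : uniformPartition M 0 ≤ uniformPartition M k.castSucc :=
    hP.strictMono.monotone (Fin.zero_le _)
  have h1 : uniformPartition M k.succ ≤ uniformPartition M (Fin.last M) :=
    hP.strictMono.monotone (Fin.le_last _)
  rw [hP.zero] at h0
  rw [hP.last] at h1
  have hfin : ∫⁻ x in cell (uniformPartition M) k, osc φ (1 / M) x ≠ ∞ := by
    rw [← hP.leb_restrict_cell]
    exact ne_top_of_le_ne_top (h.toReal_lintegral_osc_le ⟨by positivity, hMA⟩).1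
      (lintegral_mono' Measure.restrict_le_self le_rfl)
  have := ae_abs_mul_le_of_length_le h0 hlt h1 (uniformPartition_succ_sub k).le
    (hP.integrableOn_cell h.1 k) hfin
  rwa [uniformPartition_succ_sub k] at this

/-- Up to a small multiple of the norm of `V_α`, the `L¹` norm is controlled by finitely many
integrals. This is the source of all compactness in the argument. -/
theorem MemV.lOne_le_sum {α A : ℝ} {φ : ℝ → ℝ} (h : MemV α A φ) {M : ℕ} (hM : 0 < M)
    (hMA : 1 / (M : ℝ) ≤ A) :
    lOne φ ≤ ∑ k, |∫ x in cell (uniformPartition M) k, φ x| + (1 / (M : ℝ)) ^ α * gbv α A φ := by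
  have hP := isPartition_uniformPartition hM
  have hM' : (0 : ℝ) < M := by exact_mod_cast hM
  obtain ⟨hfin, hle⟩ := h.toReal_lintegral_osc_le (δ := 1 / (M : ℝ)) ⟨by positivity, hMA⟩
  rw [hP.lintegral_eq_sum] at hfin hle
  rw [ENNReal.toReal_sum fun k _ => ENNReal.sum_ne_top.1 hfin k (Finset.mem_univ k)] at hle
  refine le_trans ?_ (add_le_add_right hle _)
  rw [lOne, hP.integral_eq_sum h.1.abs, ← Finset.sum_add_distrib]
  refine Finset.sum_le_sum fun k _ => ?_
  have hvol : (volume.restrict (cell (uniformPartition M) k)).real univ = 1 / M := by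
    rw [← uniformPartition_succ_sub k]
    have hlt : uniformPartition M k.castSucc < uniformPartition M k.succ :=
      hP.strictMono Fin.castSucc_lt_succ
    simp [Measure.real, cell, hlt.le]
  have hfink : IsFiniteMeasure (volume.restrict (cell (uniformPartition M) k)) :=
    ⟨by simp [cell]⟩
  have hint : IntegrableOn (fun y => |φ y|) (cell (uniformPartition M) k) :=
    (hP.integrableOn_cell h.1 k).abs
  have h1 := integral_mono_ae (hint.mul_const (1 / (M : ℝ))) (integrable_const _)
    (h.ae_cell_abs_div_le hM hMA k)
  rw [integral_mul_const, integral_const, hvol, smul_eq_mul, mul_comm (1 / (M : ℝ))] at h1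
  exact le_of_mul_le_mul_right h1 (by positivity)

theorem exists_nat_inv_le {A : ℝ} (hA : 0 < A) : ∃ M : ℕ, 0 < M ∧ 1 / (M : ℝ) ≤ A := by
  obtain ⟨n, hn⟩ := exists_nat_one_div_lt hA
  exact ⟨n + 1, n.succ_pos, by push_cast; exact hn.le⟩

/-- `V_α` embeds continuously into `L^∞`. -/
theorem exists_ae_abs_le_gbv {α A : ℝ} (hα : 0 < α) (hA : 0 < A) :
    ∃ c : ℝ, 1 ≤ c ∧ ∀ φ, MemV α A φ → ∀ᵐ y ∂leb, |φ y| ≤ c * gbv α A φ := by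
  obtain ⟨M, hM, hMA⟩ := exists_nat_inv_le hA
  have hM' : (0 : ℝ) < M := by exact_mod_cast hM
  have hM1 : (1 : ℝ) ≤ M := by exact_mod_cast hM
  refine ⟨M, hM1, fun φ h => ?_⟩
  have hP := isPartition_uniformPartition hM
  refine hP.ae_of_forall_cell fun k => ?_
  filter_upwards [h.ae_cell_abs_div_le hM hMA k] with y hy
  obtain ⟨hfin, -⟩ := h.toReal_lintegral_osc_le (δ := 1 / (M : ℝ)) ⟨by positivity, hMA⟩
  have h1 : |∫ x in cell (uniformPartition M) k, φ x| ≤ lOne φ := by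
    refine abs_integral_le_integral_abs.trans ?_
    rw [← hP.leb_restrict_cell]
    exact setIntegral_le_integral h.1.abs (Eventually.of_forall fun _ => abs_nonneg _)
  have h2 : (∫⁻ x in cell (uniformPartition M) k, osc φ (1 / M) x).toReal ≤
      (vSeminorm α A φ).toReal := by
    refine ENNReal.toReal_mono h.2.ne ?_
    rw [← hP.leb_restrict_cell]
    refine (lintegral_mono' Measure.restrict_le_self le_rfl).trans
      ((lintegral_osc_le (α := α) φ ⟨by positivity, hMA⟩).trans (mul_le_of_le_one_right' ?_))
    rw [ENNReal.ofReal_le_one]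
    exact Real.rpow_le_one (by positivity) ((div_le_one hM').2 hM1) hα.le
  rw [mul_one_div, div_le_iff₀ hM'] at hy
  rw [h.gbv_eq]
  calc |φ y| ≤ _ := hy
    _ ≤ _ := by
      rw [mul_comm]
      refine mul_le_mul_of_nonneg_left ?_ hM'.le
      linarith

theorem Integrable.dist_toL1_eq_lOne {φ ψ : ℝ → ℝ} (h : Integrable φ leb)
    (h' : Integrable ψ leb) : dist (h.toL1 φ) (h'.toL1 ψ) = lOne fun x => φ x - ψ x := by
  rw [dist_eq_norm, ← Integrable.toL1_sub, L1.norm_of_fun_eq_integral_norm]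
  rfl

/-- Bounded subsets of `V_α` are relatively compact in `L¹`, in the form of convergence along
ultrafilters; by lower semicontinuity the limits lie in `V_α`. -/
theorem exists_lOne_limit {α A : ℝ} (hα : 0 < α) (hA : 0 < A) (𝒰 : Ultrafilter ℕ)
    {φ : ℕ → ℝ → ℝ} {B : ℝ} (hφ : ∀ n, MemV α A (φ n)) (hB : ∀ n, gbv α A (φ n) ≤ B) :
    ∃ g, MemV α A g ∧ gbv α A g ≤ 2 * B ∧
      Tendsto (fun n => lOne fun x => φ n x - g x) 𝒰 (𝓝 0) := by
  have hB0 : 0 ≤ B := (gbv_nonneg _ _ _).trans (hB 0)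
  have hC : Cauchy (map (fun n => (hφ n).1.toL1 (φ n)) (𝒰 : Filter ℕ)) := by
    refine Metric.cauchy_iff.2 ⟨inferInstance, fun e he => ?_⟩
    obtain ⟨M, hM, hMA, hMe⟩ : ∃ M : ℕ, 0 < M ∧ 1 / (M : ℝ) ≤ A ∧
        (1 / (M : ℝ)) ^ α * (2 * B) < e / 2 := by
      have h1 : Tendsto (fun M : ℕ => (1 / (M : ℝ)) ^ α * (2 * B)) atTop (𝓝 (0 ^ α * (2 * B))) :=
        ((tendsto_one_div_atTop_nhds_zero_nat).rpow_const (Or.inr hα.le)).mul_const _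
      rw [Real.zero_rpow hα.ne', zero_mul] at h1
      have h2 := h1.eventually_lt_const (half_pos he)
      have h3 : ∀ᶠ M : ℕ in atTop, 1 / (M : ℝ) ≤ A :=
        (tendsto_one_div_atTop_nhds_zero_nat (𝕜 := ℝ)).eventually_le_const hA
      obtain ⟨M, h4, h5, h6⟩ := ((eventually_gt_atTop 0).and (h3.and h2)).exists
      exact ⟨M, h4, h5, h6⟩
    have hM' : (0 : ℝ) < M := by exact_mod_cast hM
    have hP := isPartition_uniformPartition hM
    have hlim : ∀ k : Fin M, ∃ L : ℝ,
        Tendsto (fun n => ∫ x in cell (uniformPartition M) k, φ n x) 𝒰 (𝓝 L) := by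
      intro k
      have hb : ∀ n, ∫ x in cell (uniformPartition M) k, φ n x ∈ Icc (-B) B := by
        intro n
        rw [mem_Icc, ← abs_le]
        refine abs_integral_le_integral_abs.trans (le_trans ?_ ((hφ n).lOne_le.trans (hB n)))
        rw [← hP.leb_restrict_cell]
        exact setIntegral_le_integral (hφ n).1.abs (Eventually.of_forall fun _ => abs_nonneg _)
      obtain ⟨L, -, hL⟩ := (isCompact_Icc (a := -B) (b := B)).ultrafilter_le_nhds
        (𝒰.map fun n => ∫ x in cell (uniformPartition M) k, φ n x)
        (le_principal_iff.2 (mem_map.2 (univ_mem' hb)))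
      exact ⟨L, hL⟩
    choose L hL using hlim
    have hev : ∀ᶠ n in (𝒰 : Filter ℕ), ∀ k,
        |(∫ x in cell (uniformPartition M) k, φ n x) - L k| < e / (4 * M) := by
      refine eventually_all.2 fun k => ?_
      have := (Metric.tendsto_nhds.1 (hL k)) (e / (4 * M)) (by positivity)
      simpa only [Real.dist_eq] using this
    refine ⟨_, image_mem_map hev, ?_⟩
    rintro _ ⟨n, hn, rfl⟩ _ ⟨n', hn', rfl⟩
    rw [Integrable.dist_toL1_eq_lOne]
    have h1 := ((hφ n).sub (hφ n')).lOne_le_sum hM hMA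
    have h2 : ∑ k, |∫ x in cell (uniformPartition M) k, (φ n x - φ n' x)| ≤
        ∑ _k : Fin M, (e / (2 * M)) := by
      refine Finset.sum_le_sum fun k _ => ?_
      rw [integral_sub (hP.integrableOn_cell (hφ n).1 k) (hP.integrableOn_cell (hφ n').1 k)]
      have h3 := abs_lt.1 (hn k)
      have h4 := abs_lt.1 (hn' k)
      have h5 : e / (2 * M) = e / (4 * M) + e / (4 * M) := by
        field_simp; norm_num
      rw [h5, abs_le]
      constructor <;> linarith
    have h3 : ∑ _k : Fin M, (e / (2 * M)) = e / 2 := by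
      rw [Finset.sum_const, Finset.card_univ, Fintype.card_fin, nsmul_eq_mul]
      field_simp
    have h4 : (1 / (M : ℝ)) ^ α * gbv α A (fun x => φ n x - φ n' x) ≤
        (1 / (M : ℝ)) ^ α * (2 * B) := by
      refine mul_le_mul_of_nonneg_left ?_ (Real.rpow_nonneg (by positivity) _)
      linarith [(hφ n).gbv_sub_le (hφ n'), hB n, hB n']
    linarith
  obtain ⟨G, hG⟩ := CompleteSpace.complete hC
  have hGi : Integrable G leb := L1.integrable_coeFn G
  have hlim : Tendsto (fun n => lOne fun x => φ n x - G x) 𝒰 (𝓝 0) := by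
    have h1 : Tendsto (fun n => (hφ n).1.toL1 (φ n)) 𝒰 (𝓝 G) := hG
    rw [tendsto_iff_dist_tendsto_zero] at h1
    refine h1.congr fun n => ?_
    conv_lhs => rw [← Integrable.toL1_coeFn G hGi]
    exact Integrable.dist_toL1_eq_lOne _ _
  obtain ⟨u, hu⟩ : ∃ u : ℕ → ℕ, Tendsto (fun j => lOne fun x => φ (u j) x - G x) atTop (𝓝 0) := by
    have h1 : ∀ j : ℕ, ∃ n, lOne (fun x => φ n x - G x) < 1 / ((j : ℝ) + 1) := fun j =>
      (hlim.eventually_lt_const (by positivity)).exists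
    choose u hu using h1
    exact ⟨u, squeeze_zero (fun j => lOne_nonneg _) (fun j => (hu j).le)
      tendsto_one_div_add_atTop_nhds_zero_nat⟩
  have hmeas : TendstoInMeasure leb (fun j => φ (u j)) atTop G := by
    refine tendstoInMeasure_of_tendsto_eLpNorm one_ne_zero (fun j => (hφ _).1.1) hGi.1 ?_
    have h1 : ∀ j, eLpNorm (φ (u j) - ⇑G) 1 leb = ENNReal.ofReal (lOne fun x => φ (u j) x - G x) :=
      fun j => eLpNorm_eq_ofReal_lOne ((hφ _).1.sub hGi)
    simp only [h1]
    simpa using ENNReal.tendsto_ofReal hu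
  obtain ⟨v, -, hv⟩ := hmeas.exists_seq_tendsto_ae
  have hsem : vSeminorm α A G ≤ ENNReal.ofReal B := by
    refine vSeminorm_le_of_tendsto_ae hv fun n => ?_
    refine le_trans (le_trans le_self_add ((hφ (u (v n))).vNorm_eq.le)) ?_
    exact ENNReal.ofReal_le_ofReal (hB _)
  have hGV : MemV α A G := ⟨hGi, hsem.trans_lt ENNReal.ofReal_lt_top⟩
  refine ⟨G, hGV, ?_, hlim⟩
  have h1 : lOne G ≤ B := by
    have h2 : Tendsto (fun n => B + lOne fun x => φ n x - G x) 𝒰 (𝓝 (B + 0)) :=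
      hlim.const_add B
    rw [add_zero] at h2
    refine ge_of_tendsto h2 (Eventually.of_forall fun n => ?_)
    have h3 := (abs_le.1 (abs_lOne_sub_lOne_le (hφ n).1 hGi)).1
    linarith [(hφ n).lOne_le, hB n]
  have h2 := ENNReal.toReal_mono ENNReal.ofReal_ne_top hsem
  rw [ENNReal.toReal_ofReal hB0] at h2
  rw [hGV.gbv_eq]
  linarith

/-- The oscillation of a function in `V_α` around almost every point tends to zero with the radius;
hence the function is bounded below around almost every point where it is positive. -/
theorem MemV.ae_exists_lower_bound {α A : ℝ} (hα : 0 < α) (hA : 0 < A) {φ : ℝ → ℝ}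
    (h : MemV α A φ) : ∀ᵐ x ∂leb, 0 < φ x →
      ∃ U : Set ℝ, IsOpen U ∧ x ∈ U ∧ ∃ c : ℝ, 0 < c ∧ ∀ᵐ y ∂leb, y ∈ U → c ≤ φ y := by
  have hδ : ∀ n : ℕ, A / ((n : ℝ) + 1) ∈ Ioc (0 : ℝ) A := fun n =>
    ⟨by positivity, div_le_self hA.le (by linarith [n.cast_nonneg (α := ℝ)])⟩
  have hinf : ∀ᵐ x ∂leb, ⨅ n : ℕ, osc φ (A / ((n : ℝ) + 1)) x = 0 := by
    have hm : Measurable fun x => ⨅ n : ℕ, osc φ (A / ((n : ℝ) + 1)) x :=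
      Measurable.iInf fun n => measurable_osc φ _
    refine (lintegral_eq_zero_iff hm).1 (le_antisymm ?_ bot_le)
    have h1 : Tendsto (fun n : ℕ => vSeminorm α A φ * ENNReal.ofReal ((A / ((n : ℝ) + 1)) ^ α))
        atTop (𝓝 (vSeminorm α A φ * ENNReal.ofReal (0 ^ α))) := by
      refine ENNReal.Tendsto.const_mul (ENNReal.tendsto_ofReal ?_) (Or.inr h.2.ne)
      have h2 : Tendsto (fun n : ℕ => A / ((n : ℝ) + 1)) atTop (𝓝 0) := by
        have := (tendsto_one_div_add_atTop_nhds_zero_nat (𝕜 := ℝ)).const_mul A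
        simpa [div_eq_mul_inv] using this
      exact h2.rpow_const (Or.inr hα.le)
    rw [Real.zero_rpow hα.ne', ENNReal.ofReal_zero, mul_zero] at h1
    refine ge_of_tendsto h1 (Eventually.of_forall fun n => ?_)
    exact (lintegral_mono fun x => iInf_le _ n).trans (lintegral_osc_le φ (hδ n))
  have hrat : ∀ᵐ x ∂leb, ∀ n : ℕ, ∀ q : ℚ,
      x ∈ Ioo ((q : ℝ) - A / ((n : ℝ) + 1) / 2) (q + A / ((n : ℝ) + 1) / 2) →
      ∀ᵐ z ∂leb.restrict (Ioo ((q : ℝ) - A / ((n : ℝ) + 1) / 2) (q + A / ((n : ℝ) + 1) / 2)),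
        ENNReal.ofReal (φ x - φ z) ≤ osc φ (A / ((n : ℝ) + 1) / 2) q := by
    rw [ae_all_iff]
    intro n
    rw [ae_all_iff]
    intro q
    exact (ae_restrict_iff' measurableSet_Ioo).1 (ae_ae_le_osc φ _ _)
  filter_upwards [hinf, hrat] with x hx hxq hpos
  have h1 : ⨅ n : ℕ, osc φ (A / ((n : ℝ) + 1)) x < ENNReal.ofReal (φ x / 2) := by
    rw [hx]
    simpa using hpos
  obtain ⟨n, hn⟩ := iInf_lt_iff.1 h1
  set δ := A / ((n : ℝ) + 1) with hδdef
  have hδ0 : 0 < δ := (hδ n).1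
  obtain ⟨q, hq1, hq2⟩ := exists_rat_btwn (show x - δ / 2 < x by linarith)
  have hxU : x ∈ Ioo ((q : ℝ) - δ / 2) (q + δ / 2) := ⟨by linarith, by linarith⟩
  refine ⟨Ioo ((q : ℝ) - δ / 2) (q + δ / 2), isOpen_Ioo, hxU, φ x / 2, half_pos hpos, ?_⟩
  have hosc : osc φ (δ / 2) q ≤ osc φ δ x := by
    have hs : Ioo ((q : ℝ) - δ / 2) (q + δ / 2) ⊆ Ioo (x - δ) (x + δ) :=
      Ioo_subset_Ioo (by linarith) (by linarith)
    rw [osc_le_iff]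
    filter_upwards [ae_restrict_of_ae_restrict_of_subset hs (ae_ae_le_osc φ δ x)] with y hy
    exact ae_restrict_of_ae_restrict_of_subset hs hy
  rw [← ae_restrict_iff' measurableSet_Ioo]
  filter_upwards [hxq n q hxU] with z hz
  have := (ENNReal.ofReal_lt_ofReal_iff (half_pos hpos)).1 ((hz.trans hosc).trans_lt hn)
  linarith

/-! ### The transfer operator of a piecewise monotone map -/

/-- `S : [0,1] → [0,1]` is differentiable with non-vanishing derivative on each interval of the
partition `β`. -/
structure IsBranched {p : ℕ} (S : ℝ → ℝ) (β : Fin (p + 1) → ℝ) : Prop where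
  partition : IsPartition β
  mapsTo : MapsTo S (Icc 0 1) (Icc 0 1)
  differentiable : ∀ k, ∀ x ∈ cell β k, DifferentiableAt ℝ S x
  deriv_ne : ∀ k, ∀ x ∈ cell β k, deriv S x ≠ 0

/-- The contribution of the points of `I` to the transfer operator. -/
noncomputable def branchTransfer (S : ℝ → ℝ) (I : Set ℝ) (φ : ℝ → ℝ) (x : ℝ) : ℝ :=
  ∑ᶠ y ∈ {y | y ∈ I ∧ S y = x}, φ y / |deriv S y|

namespace IsBranched

variable {p : ℕ} {S : ℝ → ℝ} {β : Fin (p + 1) → ℝ} {φ φ' ψ : ℝ → ℝ}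

theorem injOn_cell (h : IsBranched S β) (k : Fin p) : InjOn S (cell β k) := by
  have key : ∀ x ∈ cell β k, ∀ y ∈ cell β k, x < y → S x ≠ S y := by
    intro x hx y hy hxy e
    have hsub : Icc x y ⊆ cell β k := fun z hz => ⟨hx.1.trans_le hz.1, hz.2.trans_lt hy.2⟩
    obtain ⟨c, hc, hc0⟩ := exists_deriv_eq_zero hxy
      (fun z hz => (h.differentiable k z (hsub hz)).continuousAt.continuousWithinAt) e
    exact h.deriv_ne k c (hsub (Ioo_subset_Icc_self hc)) hc0
  intro x hx y hy e
  rcases lt_trichotomy x y with h1 | h1 | h1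
  · exact absurd e (key x hx y hy h1)
  · exact h1
  · exact absurd e.symm (key y hy x hx h1)

theorem hasDerivWithinAt (h : IsBranched S β) (k : Fin p) :
    ∀ x ∈ cell β k, HasDerivWithinAt S (deriv S x) (cell β k) x := fun x hx =>
  (h.differentiable k x hx).hasDerivAt.hasDerivWithinAt

theorem continuousOn (h : IsBranched S β) (k : Fin p) : ContinuousOn S (cell β k) := fun x hx =>
  (h.differentiable k x hx).continuousAt.continuousWithinAt

theorem image_subset (h : IsBranched S β) (k : Fin p) : S '' cell β k ⊆ Icc 0 1 :=
  (h.mapsTo.mono_left (h.partition.cell_subset k)).image_subset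

theorem branch_fiber_finite (h : IsBranched S β) (k : Fin p) (x : ℝ) :
    {y | y ∈ cell β k ∧ S y = x}.Finite :=
  Set.Subsingleton.finite fun _ hy _ hz => h.injOn_cell k hy.1 hz.1 (hy.2.trans hz.2.symm)

theorem fiber_finite (h : IsBranched S β) (x : ℝ) :
    {y | y ∈ Icc (0 : ℝ) 1 ∧ S y = x}.Finite := by
  refine ((finite_range β).union (finite_iUnion fun k => h.branch_fiber_finite k x)).subset ?_
  rintro y ⟨hy, rfl⟩
  by_cases hyβ : y ∈ range β
  · exact Or.inl hyβ
  · obtain ⟨k, hk⟩ := h.partition.exists_mem_cell hy hyβ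
    exact Or.inr (mem_iUnion.2 ⟨k, hk, rfl⟩)

theorem branchTransfer_apply (h : IsBranched S β) {k : Fin p} {y : ℝ} (hy : y ∈ cell β k) :
    branchTransfer S (cell β k) φ (S y) = φ y / |deriv S y| := by
  have : {z | z ∈ cell β k ∧ S z = S y} = {y} := by
    ext z
    exact ⟨fun hz => h.injOn_cell k hz.1 hy hz.2, fun hz => by rw [hz]; exact ⟨hy, rfl⟩⟩
  rw [branchTransfer, this, finsum_mem_singleton]

theorem branchTransfer_eq_zero {I : Set ℝ} {x : ℝ} (hx : x ∉ S '' I) :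
    branchTransfer S I φ x = 0 := by
  have : {y | y ∈ I ∧ S y = x} = ∅ :=
    eq_empty_of_forall_notMem fun y hy => hx ⟨y, hy.1, hy.2⟩
  rw [branchTransfer, this, finsum_mem_empty]

theorem branchTransfer_nonneg {I : Set ℝ} (hφ : ∀ x, 0 ≤ φ x) (x : ℝ) :
    0 ≤ branchTransfer S I φ x :=
  finsum_nonneg fun _ => finsum_nonneg fun _ => div_nonneg (hφ _) (abs_nonneg _)

theorem transfer_eq_sum (h : IsBranched S β) {x : ℝ} (hx : x ∉ S '' range β) :
    transfer S φ x = ∑ k, branchTransfer S (cell β k) φ x := by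
  have : {y | y ∈ Icc (0 : ℝ) 1 ∧ S y = x} = ⋃ k, {y | y ∈ cell β k ∧ S y = x} := by
    ext y
    simp only [mem_ofPred_eq, mem_iUnion]
    constructor
    · rintro ⟨hy, hyx⟩
      obtain ⟨k, hk⟩ := h.partition.exists_mem_cell hy fun hyβ => hx ⟨y, hyβ, hyx⟩
      exact ⟨k, hk, hyx⟩
    · rintro ⟨k, hk, hyx⟩
      exact ⟨h.partition.cell_subset k hk, hyx⟩
  rw [transfer, this, finsum_mem_iUnion, finsum_eq_sum_of_fintype]
  · rfl
  · intro i j hij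
    exact (h.partition.disjoint_cell hij).mono (fun y hy => hy.1) fun y hy => hy.1
  · exact fun k => h.branch_fiber_finite k x

theorem transfer_ae_eq_sum (h : IsBranched S β) (φ : ℝ → ℝ) :
    ∀ᵐ x ∂leb, transfer S φ x = ∑ k, branchTransfer S (cell β k) φ x := by
  filter_upwards [measure_eq_zero_iff_ae_notMem.1
    (leb_eq_zero_of_finite ((finite_range β).image S))] with x hx
  exact h.transfer_eq_sum hx

theorem integrable_branchTransfer_mul_iff (h : IsBranched S β) (φ ψ : ℝ → ℝ) (k : Fin p) :
    Integrable (fun x => branchTransfer S (cell β k) φ x * ψ x) leb ↔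
      IntegrableOn (fun y => φ y * ψ (S y)) (cell β k) := by
  have h1 : Integrable (fun x => branchTransfer S (cell β k) φ x * ψ x) leb ↔
      IntegrableOn (fun x => branchTransfer S (cell β k) φ x * ψ x) (S '' cell β k) := by
    constructor
    · intro hi
      exact IntegrableOn.mono_set (t := Icc 0 1) hi (h.image_subset k)
    · intro hi
      refine IntegrableOn.of_forall_sdiff_eq_zero (t := Icc 0 1) hi measurableSet_Icc fun x hx => ?_
      rw [branchTransfer_eq_zero hx.2, zero_mul]
  rw [h1, integrableOn_image_iff_integrableOn_abs_deriv_smul (measurableSet_cell β k)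
    (h.hasDerivWithinAt k) (h.injOn_cell k)]
  refine integrableOn_congr_fun (fun y hy => ?_) (measurableSet_cell β k)
  have := abs_pos.2 (h.deriv_ne k y hy)
  simp only [smul_eq_mul, h.branchTransfer_apply hy]
  field_simp

theorem integral_branchTransfer_mul (h : IsBranched S β) (φ ψ : ℝ → ℝ) (k : Fin p) :
    ∫ x, branchTransfer S (cell β k) φ x * ψ x ∂leb = ∫ y in cell β k, φ y * ψ (S y) := by
  have h1 : ∫ x, branchTransfer S (cell β k) φ x * ψ x ∂leb =
      ∫ x in S '' cell β k, branchTransfer S (cell β k) φ x * ψ x := by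
    refine setIntegral_eq_of_subset_of_forall_sdiff_eq_zero measurableSet_Icc (h.image_subset k)
      fun x hx => ?_
    rw [branchTransfer_eq_zero hx.2, zero_mul]
  rw [h1, integral_image_eq_integral_abs_deriv_smul (measurableSet_cell β k)
    (h.hasDerivWithinAt k) (h.injOn_cell k)]
  refine setIntegral_congr_fun (measurableSet_cell β k) fun y hy => ?_
  have := abs_pos.2 (h.deriv_ne k y hy)
  simp only [smul_eq_mul, h.branchTransfer_apply hy]
  field_simp

theorem integrable_transfer_mul (h : IsBranched S β)
    (hi : Integrable (fun x => φ x * ψ (S x)) leb) :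
    Integrable (fun x => transfer S φ x * ψ x) leb := by
  have h1 : Integrable (fun x => ∑ k, branchTransfer S (cell β k) φ x * ψ x) leb :=
    integrable_finsetSum _ fun k _ =>
      (h.integrable_branchTransfer_mul_iff φ ψ k).2 (h.partition.integrableOn_cell hi k)
  refine h1.congr ?_
  filter_upwards [h.transfer_ae_eq_sum φ] with x hx
  rw [hx, Finset.sum_mul]

/-- The transfer operator is dual to composition with `S`. -/
theorem integral_transfer_mul (h : IsBranched S β)
    (hi : Integrable (fun x => φ x * ψ (S x)) leb) :
    ∫ x, transfer S φ x * ψ x ∂leb = ∫ x, φ x * ψ (S x) ∂leb := by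
  have h1 : ∫ x, transfer S φ x * ψ x ∂leb =
      ∫ x, ∑ k, branchTransfer S (cell β k) φ x * ψ x ∂leb := by
    refine integral_congr_ae ?_
    filter_upwards [h.transfer_ae_eq_sum φ] with x hx
    rw [hx, Finset.sum_mul]
  rw [h1, integral_finsetSum _ fun k _ =>
      (h.integrable_branchTransfer_mul_iff φ ψ k).2 (h.partition.integrableOn_cell hi k),
    h.partition.integral_eq_sum hi]
  exact Finset.sum_congr rfl fun k _ => h.integral_branchTransfer_mul φ ψ k

/-- Converse to `integrable_transfer_mul`: for non-negative `φ` no branch can cancel another. -/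
theorem integrable_of_transfer_mul (h : IsBranched S β) (hφ : Integrable φ leb)
    (hφ0 : ∀ x, 0 ≤ φ x) (hψ : AEStronglyMeasurable ψ leb)
    (hi : Integrable (fun x => transfer S φ x * ψ x) leb) :
    Integrable (fun x => φ x * ψ (S x)) leb := by
  refine h.partition.integrable_iff.2 fun k =>
    (h.integrable_branchTransfer_mul_iff φ ψ k).1 ?_
  have hm : AEStronglyMeasurable (branchTransfer S (cell β k) φ) leb := by
    have := (h.integrable_branchTransfer_mul_iff φ (fun _ => 1) k).2
      (by simpa using h.partition.integrableOn_cell hφ k)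
    simpa using this.1
  refine hi.mono (hm.mul hψ) ?_
  filter_upwards [h.transfer_ae_eq_sum φ] with x hx
  rw [norm_mul, norm_mul, hx]
  refine mul_le_mul_of_nonneg_right ?_ (norm_nonneg _)
  rw [Real.norm_of_nonneg (branchTransfer_nonneg hφ0 x),
    Real.norm_of_nonneg (Finset.sum_nonneg fun k _ => branchTransfer_nonneg hφ0 x)]
  exact Finset.single_le_sum (f := fun k => branchTransfer S (cell β k) φ x)
    (fun k _ => branchTransfer_nonneg hφ0 x) (Finset.mem_univ k)

theorem transfer_eq_finset_sum (h : IsBranched S β) (φ : ℝ → ℝ) (x : ℝ) :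
    transfer S φ x = ∑ y ∈ (h.fiber_finite x).toFinset, φ y / |deriv S y| :=
  finsum_mem_eq_finite_toFinset_sum _ _

theorem transfer_add (h : IsBranched S β) (φ φ' : ℝ → ℝ) :
    transfer S (fun x => φ x + φ' x) = fun x => transfer S φ x + transfer S φ' x := by
  ext x
  simp only [h.transfer_eq_finset_sum, ← Finset.sum_add_distrib, add_div]

theorem transfer_const_mul (h : IsBranched S β) (c : ℝ) (φ : ℝ → ℝ) :
    transfer S (fun x => c * φ x) = fun x => c * transfer S φ x := by
  ext x
  simp only [h.transfer_eq_finset_sum, Finset.mul_sum, mul_div_assoc]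

theorem transfer_mono (h : IsBranched S β) (hle : ∀ x, φ x ≤ φ' x) (x : ℝ) :
    transfer S φ x ≤ transfer S φ' x := by
  simp only [h.transfer_eq_finset_sum]
  exact Finset.sum_le_sum fun y _ => div_le_div_of_nonneg_right (hle y) (abs_nonneg _)

theorem iterate_transfer_add (h : IsBranched S β) (n : ℕ) (φ φ' : ℝ → ℝ) :
    (transfer S)^[n] (fun x => φ x + φ' x) =
      fun x => (transfer S)^[n] φ x + (transfer S)^[n] φ' x := by
  induction n generalizing φ φ' with
  | zero => rfl
  | succ n ih => simp only [Function.iterate_succ_apply, h.transfer_add, ih]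

theorem iterate_transfer_const_mul (h : IsBranched S β) (n : ℕ) (c : ℝ) (φ : ℝ → ℝ) :
    (transfer S)^[n] (fun x => c * φ x) = fun x => c * (transfer S)^[n] φ x := by
  induction n generalizing φ with
  | zero => rfl
  | succ n ih => simp only [Function.iterate_succ_apply, h.transfer_const_mul, ih]

theorem iterate_transfer_sub (h : IsBranched S β) (n : ℕ) (φ φ' : ℝ → ℝ) :
    (transfer S)^[n] (fun x => φ x - φ' x) =
      fun x => (transfer S)^[n] φ x - (transfer S)^[n] φ' x := by
  have := h.iterate_transfer_add n φ fun x => (-1) * φ' x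
  rw [h.iterate_transfer_const_mul] at this
  simpa [sub_eq_add_neg] using this

theorem iterate_transfer_mono (h : IsBranched S β) (n : ℕ) (hle : ∀ x, φ x ≤ φ' x) (x : ℝ) :
    (transfer S)^[n] φ x ≤ (transfer S)^[n] φ' x := by
  induction n generalizing φ φ' with
  | zero => exact hle x
  | succ n ih => exact ih (h.transfer_mono hle)

theorem iterate_transfer_nonneg (h : IsBranched S β) (n : ℕ) (hφ : ∀ x, 0 ≤ φ x) (x : ℝ) :
    0 ≤ (transfer S)^[n] φ x := by
  have h1 := h.iterate_transfer_mono n (φ := fun x => 0 * φ x) (φ' := φ)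
    (fun x => by simpa using hφ x) x
  rw [h.iterate_transfer_const_mul] at h1
  simpa using h1

theorem abs_iterate_transfer_le (h : IsBranched S β) (n : ℕ) (φ : ℝ → ℝ) (x : ℝ) :
    |(transfer S)^[n] φ x| ≤ (transfer S)^[n] (fun x => |φ x|) x := by
  refine abs_le'.2 ⟨h.iterate_transfer_mono n (fun x => le_abs_self _) x, ?_⟩
  have h1 := h.iterate_transfer_mono n (φ := fun x => (-1) * φ x) (φ' := fun x => |φ x|)
    (fun x => by simpa using neg_le_abs (φ x)) x
  rw [h.iterate_transfer_const_mul] at h1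
  simpa using h1

theorem iterate_transfer_mul (h : IsBranched S β) (n : ℕ)
    (hi : Integrable (fun x => φ x * ψ (S^[n] x)) leb) :
    Integrable (fun x => (transfer S)^[n] φ x * ψ x) leb ∧
      ∫ x, (transfer S)^[n] φ x * ψ x ∂leb = ∫ x, φ x * ψ (S^[n] x) ∂leb := by
  induction n generalizing φ with
  | zero => exact ⟨hi, rfl⟩
  | succ n ih =>
    have hi' : Integrable (fun x => φ x * (fun z => ψ (S^[n] z)) (S x)) leb := hi
    obtain ⟨h1, h2⟩ := ih (h.integrable_transfer_mul hi')
    exact ⟨h1, h2.trans (h.integral_transfer_mul hi')⟩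

theorem integrable_iterate_transfer (h : IsBranched S β) (n : ℕ) (hφ : Integrable φ leb) :
    Integrable ((transfer S)^[n] φ) leb := by
  simpa using (h.iterate_transfer_mul n (φ := φ) (ψ := fun _ => 1) (by simpa using hφ)).1

theorem integral_iterate_transfer (h : IsBranched S β) (n : ℕ) (hφ : Integrable φ leb) :
    ∫ x, (transfer S)^[n] φ x ∂leb = ∫ x, φ x ∂leb := by
  simpa using (h.iterate_transfer_mul n (φ := φ) (ψ := fun _ => 1) (by simpa using hφ)).2

theorem lOne_iterate_transfer_le (h : IsBranched S β) (n : ℕ) (hφ : Integrable φ leb) :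
    lOne ((transfer S)^[n] φ) ≤ lOne φ := by
  calc lOne ((transfer S)^[n] φ) ≤ ∫ x, (transfer S)^[n] (fun x => |φ x|) x ∂leb :=
        integral_mono (h.integrable_iterate_transfer n hφ).abs
          (h.integrable_iterate_transfer n hφ.abs) fun x => h.abs_iterate_transfer_le n φ x
    _ = lOne φ := h.integral_iterate_transfer n hφ.abs

theorem lOne_iterate_transfer_sub_le (h : IsBranched S β) (n : ℕ) (hφ : Integrable φ leb)
    (hφ' : Integrable φ' leb) :
    lOne (fun x => (transfer S)^[n] φ x - (transfer S)^[n] φ' x) ≤ lOne fun x => φ x - φ' x := by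
  rw [← h.iterate_transfer_sub]
  exact h.lOne_iterate_transfer_le n (hφ.sub hφ')

theorem iterate_transfer_congr (h : IsBranched S β) (n : ℕ) (hφ : Integrable φ leb)
    (e : φ =ᵐ[leb] φ') : (transfer S)^[n] φ =ᵐ[leb] (transfer S)^[n] φ' := by
  have hφ' := hφ.congr e
  have h1 := h.lOne_iterate_transfer_sub_le n hφ hφ'
  have h2 : lOne (fun x => φ x - φ' x) = 0 := integral_eq_zero_of_ae (by
    filter_upwards [e] with x hx
    simp [hx])
  have h3 := (integral_eq_zero_iff_of_nonneg (fun x => abs_nonneg _)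
    ((h.integrable_iterate_transfer n hφ).sub (h.integrable_iterate_transfer n hφ')).abs).1
    (le_antisymm (h1.trans h2.le) (lOne_nonneg _))
  filter_upwards [h3] with x hx
  exact sub_eq_zero.1 (abs_eq_zero.1 hx)

theorem aemeasurable (h : IsBranched S β) : AEMeasurable S leb := by
  rw [h.partition.leb_eq_restrict, aemeasurable_iUnion_iff]
  exact fun k => (h.continuousOn k).aemeasurable (measurableSet_cell β k)

/-- `S` is non-singular. -/
theorem map_absolutelyContinuous (h : IsBranched S β) : leb.map S ≪ leb := by
  refine Measure.AbsolutelyContinuous.mk fun s hs hs0 => ?_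
  rw [Measure.map_apply_of_aemeasurable h.aemeasurable hs]
  have hn : NullMeasurableSet (S ⁻¹' s) leb := h.aemeasurable.nullMeasurableSet_preimage hs
  have hi : Integrable (fun x => (1 : ℝ) * s.indicator 1 (S x)) leb := by
    have : (fun x => (1 : ℝ) * s.indicator 1 (S x)) = (S ⁻¹' s).indicator 1 := by
      ext x
      by_cases hx : S x ∈ s <;> simp [hx]
    rw [this]
    exact (integrable_const (1 : ℝ)).indicator₀ hn
  have h1 := h.integral_transfer_mul (φ := fun _ => 1) (ψ := s.indicator 1) hi
  have h2 : ∫ x, transfer S (fun _ => 1) x * s.indicator 1 x ∂leb = 0 := by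
    refine integral_eq_zero_of_ae ?_
    filter_upwards [measure_eq_zero_iff_ae_notMem.1 hs0] with x hx
    simp [hx]
  rw [h2] at h1
  have h3 : ∀ x, 0 ≤ (1 : ℝ) * s.indicator 1 (S x) := fun x => by
    rw [one_mul]
    exact indicator_nonneg (fun _ _ => zero_le_one) _
  rw [measure_eq_zero_iff_ae_notMem]
  filter_upwards [(integral_eq_zero_iff_of_nonneg h3 hi).1 h1.symm] with x hx hxs
  have : S x ∈ s := hxs
  simp [this] at hx

theorem aemeasurable_iterate (h : IsBranched S β) (n : ℕ) :
    AEMeasurable (S^[n]) leb ∧ leb.map (S^[n]) ≪ leb := by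
  induction n with
  | zero =>
    refine ⟨aemeasurable_id, ?_⟩
    rw [Function.iterate_zero, Measure.map_id]
  | succ n ih =>
    have h1 : AEMeasurable (S^[n]) (leb.map S) := ih.1.mono_ac h.map_absolutelyContinuous
    have h2 : AEMeasurable (S^[n + 1]) leb := h1.comp_aemeasurable h.aemeasurable
    refine ⟨h2, ?_⟩
    have h3 : leb.map (S^[n + 1]) = (leb.map S).map (S^[n]) :=
      (AEMeasurable.map_map_of_aemeasurable h1 h.aemeasurable).symm
    rw [h3]
    refine Measure.AbsolutelyContinuous.mk fun s hs hs0 => ?_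
    have h4 : leb (S^[n] ⁻¹' s) = 0 := by
      rw [← Measure.map_apply_of_aemeasurable ih.1 hs]
      exact ih.2 hs0
    rw [Measure.map_apply_of_aemeasurable h1 hs]
    exact h.map_absolutelyContinuous h4

theorem ae_iterate (h : IsBranched S β) (n : ℕ) {q : ℝ → Prop} (hq : ∀ᵐ x ∂leb, q x) :
    ∀ᵐ x ∂leb, q (S^[n] x) :=
  ae_of_ae_map (h.aemeasurable_iterate n).1 ((h.aemeasurable_iterate n).2.ae_le hq)

theorem aestronglyMeasurable_comp_iterate (h : IsBranched S β) (n : ℕ)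
    (hψ : AEStronglyMeasurable ψ leb) : AEStronglyMeasurable (fun x => ψ (S^[n] x)) leb :=
  (hψ.mono_ac (h.aemeasurable_iterate n).2).comp_aemeasurable (h.aemeasurable_iterate n).1

theorem integrable_of_iterate_transfer_mul (h : IsBranched S β) (n : ℕ) (hφ : Integrable φ leb)
    (hφ0 : ∀ x, 0 ≤ φ x) (hψ : AEStronglyMeasurable ψ leb)
    (hi : Integrable (fun x => (transfer S)^[n] φ x * ψ x) leb) :
    Integrable (fun x => φ x * ψ (S^[n] x)) leb := by
  induction n generalizing φ with
  | zero => exact hi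
  | succ n ih =>
    have h1 := ih (h.integrable_iterate_transfer 1 hφ) (h.iterate_transfer_nonneg 1 hφ0) hi
    exact h.integrable_of_transfer_mul hφ hφ0 (h.aestronglyMeasurable_comp_iterate n hψ) h1

theorem integrable_mul_comp_iterate (h : IsBranched S β) (n : ℕ) (hφ : Integrable φ leb)
    (hψ : AEStronglyMeasurable ψ leb) {C : ℝ} (hb : ∀ x, |ψ x| ≤ C) :
    Integrable (fun x => φ x * ψ (S^[n] x)) leb :=
  hφ.mul_bdd (c := C) (h.aestronglyMeasurable_comp_iterate n hψ) 
    (Eventually.of_forall fun _ => hb _)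

end IsBranched

/-! ### Lasota–Yorke inequality and invariant densities -/

/-- `S` satisfies a Lasota–Yorke inequality with constants `C` and `r`. -/
structure HasLasotaYorke (α A C r : ℝ) (S : ℝ → ℝ) : Prop where
  one_le : 1 ≤ C
  pos : 0 < r
  lt_one : r < 1
  memV : ∀ φ, MemV α A φ → ∀ n, MemV α A ((transfer S)^[n] φ)
  bound : ∀ φ, MemV α A φ → ∀ n,
    gbv α A ((transfer S)^[n] φ) ≤ C * r ^ n * gbv α A φ + C * lOne φ

theorem HasLasotaYorke.gbv_iterate_le {α A C r : ℝ} {S : ℝ → ℝ} (h : HasLasotaYorke α A C r S)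
    {φ : ℝ → ℝ} (hφ : MemV α A φ) (n : ℕ) :
    gbv α A ((transfer S)^[n] φ) ≤ 2 * C * gbv α A φ := by
  have h1 := h.bound φ hφ n
  have hC := h.one_le
  have h2 : C * r ^ n * gbv α A φ ≤ C * 1 * gbv α A φ := by
    gcongr
    · exact gbv_nonneg _ _ _
    · exact pow_le_one₀ h.pos.le h.lt_one.le
  have h3 : C * lOne φ ≤ C * gbv α A φ := by
    gcongr
    exact hφ.lOne_le
  linarith

section Density

variable {p : ℕ} {S : ℝ → ℝ} {β : Fin (p + 1) → ℝ}

theorem withDensity_apply_eq_ofReal {w : ℝ → ℝ} (hw : Integrable w leb) (hw0 : ∀ᵐ x ∂leb, 0 ≤ w x)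
    (s : Set ℝ) : (leb.withDensity fun x => ENNReal.ofReal (w x)) s =
      ENNReal.ofReal (∫ x in s, w x ∂leb) := by
  rw [withDensity_apply', ofReal_integral_eq_lintegral_ofReal hw.integrableOn
    (ae_restrict_of_ae hw0)]

theorem IsBranched.isAcip_withDensity (h : IsBranched S β) {w : ℝ → ℝ} (hw : Integrable w leb)
    (hw0 : ∀ᵐ x ∂leb, 0 ≤ w x) (hw1 : ∫ x, w x ∂leb = 1) (hP : transfer S w =ᵐ[leb] w) :
    IsAcip S (leb.withDensity fun x => ENNReal.ofReal (w x)) := by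
  refine ⟨⟨?_⟩, withDensity_absolutelyContinuous _ _, ?_⟩
  · rw [withDensity_apply_eq_ofReal hw hw0, Measure.restrict_univ, hw1, ENNReal.ofReal_one]
  · ext s hs
    have hm : AEMeasurable S (leb.withDensity fun x => ENNReal.ofReal (w x)) :=
      h.aemeasurable.mono_ac (withDensity_absolutelyContinuous _ _)
    rw [Measure.map_apply_of_aemeasurable hm hs, withDensity_apply_eq_ofReal hw hw0,
      withDensity_apply_eq_ofReal hw hw0]
    congr 1
    have hn : NullMeasurableSet (S ⁻¹' s) leb := h.aemeasurable.nullMeasurableSet_preimage hs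
    rw [← integral_indicator₀ hn, ← integral_indicator hs]
    have e1 : (S ⁻¹' s).indicator w = fun x => w x * s.indicator 1 (S x) := by
      ext x
      by_cases hx : S x ∈ s <;> simp [hx]
    have e2 : ∫ x, transfer S w x * s.indicator 1 x ∂leb = ∫ x, s.indicator w x ∂leb := by
      refine integral_congr_ae ?_
      filter_upwards [hP] with x hx
      by_cases hxs : x ∈ s <;> simp [hxs, hx]
    rw [← e2, h.integral_transfer_mul, e1]
    rw [← e1]
    exact hw.indicator₀ hn

/-- Almost everywhere equality in terms of the `L¹` distance. -/
theorem ae_eq_of_lOne_sub_le {φ ψ : ℝ → ℝ} (hφ : Integrable φ leb) (hψ : Integrable ψ leb)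
    (h : lOne (fun x => φ x - ψ x) ≤ 0) : φ =ᵐ[leb] ψ := by
  have h3 := (integral_eq_zero_iff_of_nonneg (fun x => abs_nonneg _) (hφ.sub hψ).abs).1
    (le_antisymm h (lOne_nonneg _))
  filter_upwards [h3] with x hx
  exact sub_eq_zero.1 (abs_eq_zero.1 hx)

theorem abs_setIntegral_sub_le {φ ψ : ℝ → ℝ} (hφ : Integrable φ leb) (hψ : Integrable ψ leb)
    (s : Set ℝ) :
    |(∫ x in s, φ x ∂leb) - ∫ x in s, ψ x ∂leb| ≤ lOne fun x => φ x - ψ x := by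
  rw [← integral_sub hφ.integrableOn hψ.integrableOn]
  exact abs_integral_le_integral_abs.trans
    (setIntegral_le_integral (hφ.sub hψ).abs (Eventually.of_forall fun _ => abs_nonneg _))

/-- The Birkhoff sums `∑_{k < n} P^k u` of the transfer operator. -/
theorem HasLasotaYorke.birkhoffSum {α A C r : ℝ} (h : IsBranched S β)
    (hLY : HasLasotaYorke α A C r S) {u : ℝ → ℝ} (hu : MemV α A u) (n : ℕ) :
    MemV α A (fun x => ∑ k ∈ Finset.range n, (transfer S)^[k] u x) ∧
    gbv α A (fun x => ∑ k ∈ Finset.range n, (transfer S)^[k] u x) ≤ n * (2 * C * gbv α A u) ∧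
    (∀ x, transfer S (fun x => ∑ k ∈ Finset.range n, (transfer S)^[k] u x) x =
      (∑ k ∈ Finset.range n, (transfer S)^[k] u x) + ((transfer S)^[n] u x - u x)) ∧
    ∀ s : Set ℝ, ∫ x in s, ∑ k ∈ Finset.range n, (transfer S)^[k] u x ∂leb =
      ∑ k ∈ Finset.range n, ∫ x in s, (transfer S)^[k] u x ∂leb := by
  induction n with
  | zero =>
    refine ⟨by simpa using MemV.const α A 0, ?_, fun x => ?_, ?_⟩
    · simp [gbv_const]
    · have := congrFun (h.transfer_const_mul 0 u) x
      simpa using this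
    · simp
  | succ n ih =>
    obtain ⟨h1, h2, h3, h4⟩ := ih
    have h5 := hLY.memV u hu n
    simp only [Finset.sum_range_succ]
    refine ⟨h1.add h5, ?_, fun x => ?_, fun s => ?_⟩
    · have := h1.gbv_add_le h5
      have h6 := hLY.gbv_iterate_le hu n
      push_cast
      linarith
    · rw [h.transfer_add]
      beta_reduce
      rw [h3, Function.iterate_succ_apply']
      ring
    · rw [integral_add h1.1.integrableOn h5.1.integrableOn, h4]

/-- Krylov–Bogolyubov: a limit of the Cesàro means of `P^k u` is an invariant density. -/
theorem HasLasotaYorke.exists_invariant {α A C r : ℝ} (hα : 0 < α) (hA : 0 < A)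
    (h : IsBranched S β) (hLY : HasLasotaYorke α A C r S) {u : ℝ → ℝ} (hu : MemV α A u)
    (hu0 : ∀ x, 0 ≤ u x) :
    ∃ w, MemV α A w ∧ gbv α A w ≤ 4 * C * gbv α A u ∧ (∀ᵐ x ∂leb, 0 ≤ w x) ∧
      transfer S w =ᵐ[leb] w ∧ ∫ x, w x ∂leb = ∫ x, u x ∂leb ∧
      ∀ s : Set ℝ, (∀ k, ∫ x in s, (transfer S)^[k] u x ∂leb = 0) → ∫ x in s, w x ∂leb = 0 := by
  set c : ℕ → ℝ → ℝ := fun n x =>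
    ((n : ℝ) + 1)⁻¹ * ∑ k ∈ Finset.range (n + 1), (transfer S)^[k] u x with hc
  have hn : ∀ n : ℕ, (0 : ℝ) < (n : ℝ) + 1 := fun n => by positivity
  have hcV : ∀ n, MemV α A (c n) := fun n =>
    (hLY.birkhoffSum h hu (n + 1)).1.const_mul _
  have hcB : ∀ n, gbv α A (c n) ≤ 2 * C * gbv α A u := by
    intro n
    have h1 := hLY.birkhoffSum h hu (n + 1)
    refine (h1.1.gbv_const_mul_le _).trans ?_
    rw [abs_of_pos (inv_pos.2 (hn n)), inv_mul_le_iff₀ (hn n)]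
    have := h1.2.1
    push_cast at this
    exact this
  have hc0 : ∀ n x, 0 ≤ c n x := fun n x => mul_nonneg (inv_nonneg.2 (hn n).le)
    (Finset.sum_nonneg fun k _ => h.iterate_transfer_nonneg k hu0 x)
  have hcP : ∀ n, lOne (fun x => transfer S (c n) x - c n x) ≤
      2 * lOne u * (1 / ((n : ℝ) + 1)) := by
    intro n
    have h1 := hLY.birkhoffSum h hu (n + 1)
    have e : (fun x => transfer S (c n) x - c n x) =
        fun x => ((n : ℝ) + 1)⁻¹ * ((transfer S)^[n + 1] u x - u x) := by
      ext x
      rw [hc, h.transfer_const_mul]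
      beta_reduce
      rw [h1.2.2.1]
      ring
    rw [e]
    have h2 := lOne_sub_le (h.integrable_iterate_transfer (n + 1) hu.1) (integrable_const (0 : ℝ))
      hu.1
    simp only [sub_zero, zero_sub] at h2
    have h3 : lOne (fun x => -u x) = lOne u := by simp only [lOne, abs_neg]
    have h4 := h.lOne_iterate_transfer_le (n + 1) hu.1
    have h5 : lOne (fun x => ((n : ℝ) + 1)⁻¹ * ((transfer S)^[n + 1] u x - u x)) =
        ((n : ℝ) + 1)⁻¹ * lOne fun x => (transfer S)^[n + 1] u x - u x := by
      simp only [lOne, abs_mul, abs_of_pos (inv_pos.2 (hn n))]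
      exact integral_const_mul _ _
    rw [h5, one_div, mul_comm]
    refine mul_le_mul_of_nonneg_right ?_ (inv_nonneg.2 (hn n).le)
    have h2' : lOne (fun x => (transfer S)^[n + 1] u x - u x) ≤
        lOne ((transfer S)^[n + 1] u) + lOne fun x => -u x := h2
    linarith
  obtain ⟨w, hwV, hwB, hlim⟩ := exists_lOne_limit hα hA (hyperfilter ℕ) hcV hcB
  have hset : ∀ s : Set ℝ, Tendsto (fun n => ∫ x in s, c n x ∂leb) (hyperfilter ℕ : Ultrafilter ℕ)
      (𝓝 (∫ x in s, w x ∂leb)) := by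
    intro s
    rw [tendsto_iff_norm_sub_tendsto_zero]
    exact squeeze_zero (fun n => norm_nonneg _)
      (fun n => abs_setIntegral_sub_le (hcV n).1 hwV.1 s) hlim
  have hcs : ∀ n (s : Set ℝ), ∫ x in s, c n x ∂leb =
      ((n : ℝ) + 1)⁻¹ * ∑ k ∈ Finset.range (n + 1), ∫ x in s, (transfer S)^[k] u x ∂leb := by
    intro n s
    rw [← (hLY.birkhoffSum h hu (n + 1)).2.2.2 s]
    exact integral_const_mul _ _
  refine ⟨w, hwV, by linarith, ?_, ?_, ?_, ?_⟩
  · have hneg : Integrable (fun x => max (-w x) 0) leb := hwV.1.neg.pos_part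
    have h1 : ∫ x, max (-w x) 0 ∂leb ≤ 0 := by
      refine ge_of_tendsto hlim (Eventually.of_forall fun n => ?_)
      refine integral_mono hneg ((hcV n).1.sub hwV.1).abs fun x => ?_
      refine max_le ?_ (abs_nonneg _)
      exact le_trans (by linarith [hc0 n x]) (le_abs_self (c n x - w x))
    have h2 := (integral_eq_zero_iff_of_nonneg (fun x => le_max_right _ _) hneg).1
      (le_antisymm h1 (integral_nonneg fun x => le_max_right _ _))
    filter_upwards [h2] with x hx
    have : max (-w x) 0 = 0 := hx
    linarith [le_max_left (-w x) 0]
  · have hPw := h.integrable_iterate_transfer 1 hwV.1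
    refine ae_eq_of_lOne_sub_le hPw hwV.1 ?_
    have h1 : Tendsto (fun n : ℕ => (lOne fun x => c n x - w x) +
        (2 * lOne u * (1 / ((n : ℝ) + 1)) + lOne fun x => c n x - w x))
        (hyperfilter ℕ : Ultrafilter ℕ) (𝓝 (0 + (2 * lOne u * 0 + 0))) :=
      hlim.add (((tendsto_one_div_add_atTop_nhds_zero_nat.mono_left
        Nat.hyperfilter_le_atTop).const_mul _).add hlim)
    simp only [mul_zero, add_zero] at h1
    refine ge_of_tendsto h1 (Eventually.of_forall fun n => ?_)
    have hPc := h.integrable_iterate_transfer 1 (hcV n).1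
    have h2 := lOne_sub_le hPw hPc hwV.1
    have h3 := lOne_sub_le hPc (hcV n).1 hwV.1
    have h4 := h.lOne_iterate_transfer_sub_le 1 hwV.1 (hcV n).1
    rw [lOne_sub_comm w] at h4
    have h5 := hcP n
    simp only [Function.iterate_one] at h2 h3 h4 ⊢
    linarith
  · have h1 := hset univ
    rw [Measure.restrict_univ] at h1
    refine tendsto_nhds_unique (Tendsto.congr (fun n => ?_) h1) tendsto_const_nhds
    have h2 := hcs n univ
    have := (hn n).ne'
    simp only [Measure.restrict_univ, h.integral_iterate_transfer _ hu.1, Finset.sum_const,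
      Finset.card_range, nsmul_eq_mul] at h2
    rw [h2]
    push_cast
    field_simp
  · intro s hs
    have h1 := hset s
    simp only [hcs, hs, Finset.sum_const_zero, mul_zero] at h1
    exact tendsto_nhds_unique h1 tendsto_const_nhds

end Density

/-! ### Convergence to equilibrium for a mixing map -/

/-- `g ∈ V_α` is recurrent under the transfer operator `P`: all `P^k g` have the same `L¹` norm,
and `P^k g` returns to `g` in the norm of `V_α` at arbitrarily large times. -/
structure IsRecurrent (α A : ℝ) (S g : ℝ → ℝ) : Prop where
  memV : MemV α A g
  lOne_eq : ∀ k, lOne ((transfer S)^[k] g) = lOne g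
  returns : ∀ η : ℝ, 0 < η → ∀ N : ℕ, ∃ k ≥ N,
    gbv α A (fun x => (transfer S)^[k] g x - g x) ≤ η

section Mixing

variable {p : ℕ} {S : ℝ → ℝ} {β : Fin (p + 1) → ℝ} {α A C r : ℝ}

/-- Every orbit of the transfer operator in `V_α` accumulates, in the norm of `V_α`, at a recurrent
function. The limit `g` is also the image under `P^m` of the limit of `P^{n - m} f`, for every `m`;
the Lasota–Yorke inequality for `P^m` therefore turns `L¹` convergence into convergence in `V_α`. -/
theorem HasLasotaYorke.exists_recurrent (hα : 0 < α) (hA : 0 < A) (h : IsBranched S β)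
    (hLY : HasLasotaYorke α A C r S) {f : ℝ → ℝ} (hf : MemV α A f) :
    ∃ g, IsRecurrent α A S g ∧ ∫ x, g x ∂leb = ∫ x, f x ∂leb ∧
      Tendsto (fun n => lOne ((transfer S)^[n] f)) atTop (𝓝 (lOne g)) := by
  have hC := hLY.one_le
  set 𝒰 : Ultrafilter ℕ := hyperfilter ℕ with h𝒰
  have hle : (𝒰 : Filter ℕ) ≤ atTop := Nat.hyperfilter_le_atTop
  set B := 2 * C * gbv α A f with hBdef
  have hlim := fun m : ℕ => exists_lOne_limit hα hA 𝒰
    (φ := fun n => (transfer S)^[n - m] f) (fun n => hLY.memV f hf (n - m))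
    (fun n => hLY.gbv_iterate_le hf (n - m))
  choose G hGV hGB hG using hlim
  set g := G 0 with hg
  have hfn : ∀ n, MemV α A ((transfer S)^[n] f) := hLY.memV f hf
  have hsplit : ∀ m n : ℕ, m ≤ n → (transfer S)^[m] ((transfer S)^[n - m] f) =
      (transfer S)^[n] f := fun m n hmn => by
    rw [← Function.iterate_add_apply, Nat.add_sub_cancel' hmn]
  have hG0 : Tendsto (fun n => lOne fun x => (transfer S)^[n] f x - g x) 𝒰 (𝓝 0) := hG 0
  -- `P^m G_m = G_0`
  have hGm : ∀ m, (transfer S)^[m] (G m) =ᵐ[leb] g := by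
    intro m
    have hi := h.integrable_iterate_transfer m (hGV m).1
    refine ae_eq_of_lOne_sub_le hi (hGV 0).1 ?_
    have h1 := (hG m).add hG0
    rw [add_zero] at h1
    refine ge_of_tendsto h1 ?_
    filter_upwards [hle (eventually_ge_atTop m)] with n hn
    have h2 := lOne_sub_le hi (hfn n).1 (hGV 0).1
    have h3 := h.lOne_iterate_transfer_sub_le m (hGV m).1 (hfn (n - m)).1
    rw [lOne_sub_comm (G m), hsplit m n hn] at h3
    linarith
  -- convergence in the norm of `V_α`
  have hV : ∀ η : ℝ, 0 < η → ∀ᶠ n in (𝒰 : Filter ℕ),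
      gbv α A (fun x => (transfer S)^[n] f x - g x) ≤ η := by
    intro η hη
    have hB0 : 0 ≤ B := (gbv_nonneg _ _ _).trans (hLY.gbv_iterate_le hf 0)
    obtain ⟨m, hm⟩ : ∃ m : ℕ, C * r ^ m * (3 * B) < η / 2 := by
      have h1 : Tendsto (fun m : ℕ => C * r ^ m * (3 * B)) atTop (𝓝 (C * 0 * (3 * B))) :=
        ((tendsto_pow_atTop_nhds_zero_of_lt_one hLY.pos.le hLY.lt_one).const_mul C).mul_const _
      rw [mul_zero, zero_mul] at h1
      exact (h1.eventually_lt_const (half_pos hη)).exists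
    have h2 := (hG m).eventually_lt_const (show 0 < η / (2 * C) by positivity)
    filter_upwards [h2, hle (eventually_ge_atTop m)] with n h3 hn
    have hd := (hfn (n - m)).sub (hGV m)
    have e : (fun x => (transfer S)^[n] f x - g x) =ᵐ[leb]
        (transfer S)^[m] (fun x => (transfer S)^[n - m] f x - G m x) := by
      rw [h.iterate_transfer_sub, hsplit m n hn]
      filter_upwards [hGm m] with x hx
      rw [hx]
    rw [gbv_congr e]
    refine (hLY.bound _ hd m).trans ?_
    have h4 : gbv α A (fun x => (transfer S)^[n - m] f x - G m x) ≤ 3 * B := by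
      have := (hfn (n - m)).gbv_sub_le (hGV m)
      have h5 := hLY.gbv_iterate_le hf (n - m)
      linarith [hGB m]
    have h5 : C * r ^ m * gbv α A (fun x => (transfer S)^[n - m] f x - G m x) ≤
        C * r ^ m * (3 * B) :=
      mul_le_mul_of_nonneg_left h4 (mul_nonneg (by linarith) (pow_nonneg hLY.pos.le _))
    have h6 : C * lOne (fun x => (transfer S)^[n - m] f x - G m x) ≤ C * (η / (2 * C)) :=
      mul_le_mul_of_nonneg_left h3.le (by linarith)
    have h7 : C * (η / (2 * C)) = η / 2 := by field_simp
    linarith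
  -- the `L¹` norms decrease to `lOne g`
  have hanti : Antitone fun n => lOne ((transfer S)^[n] f) := antitone_nat_of_succ_le fun n => by
    rw [Function.iterate_succ_apply']
    exact h.lOne_iterate_transfer_le 1 (hfn n).1
  have hshift : ∀ k, Tendsto (fun n => lOne ((transfer S)^[n + k] f)) 𝒰
      (𝓝 (lOne ((transfer S)^[k] g))) := by
    intro k
    rw [tendsto_iff_norm_sub_tendsto_zero]
    refine squeeze_zero (fun n => norm_nonneg _) (fun n => ?_) hG0
    have h1 := h.lOne_iterate_transfer_sub_le k (hfn n).1 (hGV 0).1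
    rw [← Function.iterate_add_apply, add_comm k n] at h1
    exact (abs_lOne_sub_lOne_le (hfn (n + k)).1
      (h.integrable_iterate_transfer k (hGV 0).1)).trans h1
  have hconv : Tendsto (fun n => lOne ((transfer S)^[n] f)) atTop (𝓝 (lOne g)) := by
    have h1 := tendsto_atTop_ciInf hanti ⟨0, by rintro _ ⟨n, rfl⟩; exact lOne_nonneg _⟩
    rwa [tendsto_nhds_unique (h1.mono_left hle) (hshift 0)] at h1
  refine ⟨g, ⟨hGV 0, fun k => ?_, fun η hη N => ?_⟩, ?_, hconv⟩
  · exact tendsto_nhds_unique (hshift k)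
      ((hconv.comp (tendsto_add_atTop_nat k)).mono_left hle)
  · have hη' : 0 < η / (3 * C) := by positivity
    obtain ⟨n, hn⟩ := (hV _ hη').exists
    obtain ⟨n', hn', hnn'⟩ := ((hV _ hη').and (hle (eventually_ge_atTop (n + N)))).exists
    refine ⟨n' - n, by omega, ?_⟩
    have e : (fun x => (transfer S)^[n' - n] g x - g x) =
        fun x => ((transfer S)^[n'] f x - g x) -
          (transfer S)^[n' - n] (fun x => (transfer S)^[n] f x - g x) x := by
      ext x
      rw [h.iterate_transfer_sub, ← Function.iterate_add_apply, Nat.sub_add_cancel (by omega)]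
      ring
    have hd := (hfn n).sub (hGV 0)
    rw [e]
    refine (((hfn n').sub (hGV 0)).gbv_sub_le (hLY.memV _ hd _)).trans ?_
    have h1 := hLY.gbv_iterate_le hd (n' - n)
    have h2 : 2 * C * gbv α A (fun x => (transfer S)^[n] f x - g x) ≤ 2 * C * (η / (3 * C)) :=
      mul_le_mul_of_nonneg_left hn (by linarith)
    have h3 : 2 * C * (η / (3 * C)) = 2 / 3 * η := by field_simp
    have h4 : η / (3 * C) ≤ 1 / 3 * η := by
      rw [div_le_iff₀ (by positivity)]
      nlinarith
    linarith
  · have h1 : Tendsto (fun n => ∫ x, (transfer S)^[n] f x ∂leb) 𝒰 (𝓝 (∫ x, g x ∂leb)) := by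
      rw [tendsto_iff_norm_sub_tendsto_zero]
      refine squeeze_zero (fun n => norm_nonneg _) (fun n => ?_) hG0
      rw [← integral_sub (hfn n).1 (hGV 0).1]
      exact abs_integral_le_lOne _
    simp only [h.integral_iterate_transfer _ hf.1] at h1
    exact tendsto_nhds_unique h1 tendsto_const_nhds

theorem IsRecurrent.neg (h : IsBranched S β) (hLY : HasLasotaYorke α A C r S) {g : ℝ → ℝ} (hg : IsRecurrent α A S g) :
    IsRecurrent α A S fun x => -g x := by
  have e : ∀ k, (transfer S)^[k] (fun x => -g x) = fun x => -(transfer S)^[k] g x := by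
    intro k
    have := h.iterate_transfer_const_mul k (-1) g
    simpa using this
  refine ⟨?_, fun k => ?_, fun η hη N => ?_⟩
  · simpa using hg.memV.const_mul (-1)
  · rw [e]
    have := hg.lOne_eq k
    simpa only [lOne, abs_neg] using this
  · obtain ⟨k, hk, hk'⟩ := hg.returns η hη N
    refine ⟨k, hk, ?_⟩
    have h1 := ((hLY.memV g hg.memV k).sub hg.memV).gbv_const_mul_le (-1)
    have e2 : (fun x => (transfer S)^[k] (fun x => -g x) x - -g x) =
        fun x => (-1) * ((transfer S)^[k] g x - g x) := by
      rw [e]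
      ext x
      ring
    rw [e2]
    simp only [abs_neg, abs_one, one_mul] at h1
    exact h1.trans hk'

/-- No cancellation takes place along the orbit of a function whose `L¹` norm is preserved. -/
theorem IsRecurrent.iterate_posPart (h : IsBranched S β) {g : ℝ → ℝ} (hg : IsRecurrent α A S g)
    (k : ℕ) : ∀ᵐ x ∂leb, (transfer S)^[k] (fun x => max (g x) 0) x =
      max ((transfer S)^[k] g x) 0 := by
  have hp : Integrable (fun x => max (g x) 0) leb := hg.memV.1.pos_part
  have hn : Integrable (fun x => max (-g x) 0) leb := hg.memV.1.neg.pos_part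
  have hip := h.integrable_iterate_transfer k hp
  have hin := h.integrable_iterate_transfer k hn
  set a := (transfer S)^[k] fun x => max (g x) 0 with ha
  set b := (transfer S)^[k] fun x => max (-g x) 0 with hb
  have ha0 : ∀ x, 0 ≤ a x := h.iterate_transfer_nonneg k fun x => le_max_right _ _
  have hb0 : ∀ x, 0 ≤ b x := h.iterate_transfer_nonneg k fun x => le_max_right _ _
  have e : (transfer S)^[k] g = fun x => a x - b x := by
    rw [ha, hb, ← h.iterate_transfer_sub]
    congr 1
    ext x
    rcases le_total 0 (g x) with h1 | h1
    · rw [max_eq_left h1, max_eq_right (by linarith), sub_zero]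
    · rw [max_eq_right h1, max_eq_left (by linarith)]
      ring
  have h1 : ∫ x, (a x + b x - |a x - b x|) ∂leb = 0 := by
    have h2 : lOne g = ∫ x, (max (g x) 0 + max (-g x) 0) ∂leb := by
      refine integral_congr_ae (Eventually.of_forall fun x => ?_)
      rcases le_total 0 (g x) with h1 | h1
      · simp only [max_eq_left h1, max_eq_right (neg_nonpos.2 h1), add_zero, abs_of_nonneg h1]
      · simp only [max_eq_right h1, max_eq_left (neg_nonneg.2 h1), zero_add, abs_of_nonpos h1]
    have h3 := hg.lOne_eq k
    rw [e, h2, integral_add hp hn, ← h.integral_iterate_transfer k hp,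
      ← h.integral_iterate_transfer k hn] at h3
    have h4 : ∫ x, (a x + b x - |a x - b x|) ∂leb =
        (∫ x, a x ∂leb + ∫ x, b x ∂leb) - lOne fun x => a x - b x := by
      rw [← integral_add hip hin]
      exact integral_sub (hip.add hin) (hip.sub hin).abs
    rw [h4, h3, sub_self]
  have h2 := (integral_eq_zero_iff_of_nonneg (fun x => by
    have : |a x - b x| ≤ a x + b x := abs_le.2 ⟨by linarith [ha0 x, hb0 x],
      by linarith [ha0 x, hb0 x]⟩
    exact sub_nonneg.2 this) ((hip.add hin).sub (hip.sub hin).abs)).1 h1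
  filter_upwards [h2] with x hx
  have hx' : a x + b x - |a x - b x| = 0 := hx
  rw [e]
  beta_reduce
  rcases le_total (b x) (a x) with h3 | h3
  · rw [abs_of_nonneg (sub_nonneg.2 h3)] at hx'
    rw [max_eq_left (sub_nonneg.2 h3)]
    linarith
  · rw [abs_of_nonpos (sub_nonpos.2 h3)] at hx'
    rw [max_eq_right (sub_nonpos.2 h3)]
    linarith

/-- The support of an invariant measure is forward invariant up to null sets, because `S` is
continuous off the partition points. -/
theorem IsBranched.ae_mem_support (h : IsBranched S β) {ν : Measure ℝ} (hν : IsAcip S ν) :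
    ∀ᵐ x ∂leb, x ∈ ν.support → S x ∈ ν.support := by
  filter_upwards [measure_eq_zero_iff_ae_notMem.1 (leb_eq_zero_of_finite (finite_range β)),
    ae_mem_Icc] with x hxβ hx hxK
  by_contra hSx
  obtain ⟨k, hk⟩ := h.partition.exists_mem_cell hx hxβ
  have h1 : S ⁻¹' ν.supportᶜ ∈ 𝓝 x := (h.differentiable k x hk).continuousAt.preimage_mem_nhds
    (Measure.isOpen_compl_support.mem_nhds hSx)
  have h2 := (Measure.mem_support_iff_forall x).1 hxK _ h1
  rw [← Measure.map_apply_of_aemeasurable (h.aemeasurable.mono_ac hν.2.1)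
    Measure.isOpen_compl_support.measurableSet, hν.2.2, Measure.measure_compl_support] at h2
  exact lt_irrefl _ h2

theorem IsBranched.setIntegral_support_mono (h : IsBranched S β) {ν : Measure ℝ}
    (hν : IsAcip S ν) {u : ℝ → ℝ} (hu : Integrable u leb) (hu0 : ∀ x, 0 ≤ u x) :
    Monotone fun k => ∫ x in ν.support, (transfer S)^[k] u x ∂leb := by
  have hK : MeasurableSet ν.support := Measure.isClosed_support.measurableSet
  refine monotone_nat_of_le_succ fun k => ?_
  have hi := h.integrable_iterate_transfer k hu
  have hi0 := h.iterate_transfer_nonneg k hu0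
  rw [Function.iterate_succ_apply']
  set v := (transfer S)^[k] u
  have e : ∀ w : ℝ → ℝ, ∫ x in ν.support, w x ∂leb =
      ∫ x, w x * ν.support.indicator 1 x ∂leb := by
    intro w
    rw [← integral_indicator hK]
    congr 1
    ext x
    by_cases hx : x ∈ ν.support <;> simp [hx]
  have hind : ∀ x, |ν.support.indicator (1 : ℝ → ℝ) x| ≤ 1 := fun x => by
    by_cases hx : x ∈ ν.support <;> simp [hx]
  have hm : AEStronglyMeasurable (ν.support.indicator (1 : ℝ → ℝ)) leb :=
    (measurable_one.indicator hK).aestronglyMeasurable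
  have h1 := h.integrable_mul_comp_iterate 1 hi hm hind
  have h0 := h.integrable_mul_comp_iterate 0 hi hm hind
  rw [e, e, h.integral_transfer_mul h1]
  refine integral_mono_ae h0 h1 ?_
  filter_upwards [h.ae_mem_support hν] with x hx
  refine mul_le_mul_of_nonneg_left ?_ (hi0 x)
  by_cases hxK : x ∈ ν.support
  · simp [hxK, hx hxK]
  · simp only [indicator_of_notMem hxK]
    exact indicator_nonneg (fun _ _ => zero_le_one) _

/-- The positive part of a recurrent function does not vanish on the support of the unique acip
`ν`. Otherwise, by recurrence and forward invariance of the support, its orbit would never charge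
the support, and the limit of the Cesàro means would be the density of an acip other than `ν`. -/
theorem IsRecurrent.exists_pos_on_support (hα : 0 < α) (hA : 0 < A) (h : IsBranched S β)
    (hLY : HasLasotaYorke α A C r S) {ν : Measure ℝ} (hν : IsAcip S ν)
    (huniq : ∀ ν', IsAcip S ν' → ν' = ν) {g : ℝ → ℝ} (hg : IsRecurrent α A S g)
    (hpos : 0 < ∫ x, max (g x) 0 ∂leb) : ∃ᵐ x ∂leb, x ∈ ν.support ∧ 0 < g x := by
  intro hcon
  set u : ℝ → ℝ := fun x => max (g x) 0 with hu
  have huV : MemV α A u := hg.memV.pos_part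
  have hu0 : ∀ x, 0 ≤ u x := fun x => le_max_right _ _
  have hmono := h.setIntegral_support_mono hν huV.1 hu0
  have hstart : ∫ x in ν.support, u x ∂leb = 0 := by
    refine setIntegral_eq_zero_of_ae_eq_zero ?_
    filter_upwards [hcon] with x hx hxK
    exact max_eq_right (not_lt.1 fun h1 => hx ⟨hxK, h1⟩)
  have hzero : ∀ k, ∫ x in ν.support, (transfer S)^[k] u x ∂leb = 0 := by
    intro N
    refine le_antisymm (le_of_forall_pos_le_add fun η hη => ?_)
      (integral_nonneg (h.iterate_transfer_nonneg N hu0))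
    obtain ⟨k, hk, hkη⟩ := hg.returns η hη N
    rw [zero_add]
    refine (hmono hk).trans ?_
    have hd := (hLY.memV g hg.memV k).sub hg.memV
    have h1 := abs_setIntegral_sub_le (h.integrable_iterate_transfer k huV.1) huV.1 ν.support
    rw [hstart, sub_zero] at h1
    refine (le_abs_self _).trans (h1.trans (le_trans ?_ (hd.lOne_le.trans hkη)))
    refine integral_mono_ae ((h.integrable_iterate_transfer k huV.1).sub huV.1).abs hd.1.abs ?_
    filter_upwards [hg.iterate_posPart h k] with x hx
    rw [hx]
    exact abs_max_sub_max_le_abs _ _ _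
  obtain ⟨w, hwV, -, hw0, hwP, hwi, hws⟩ := hLY.exists_invariant hα hA h huV hu0
  set c := ∫ x, u x ∂leb with hc
  have hwi' : ∫ x, c⁻¹ * w x ∂leb = 1 := by
    rw [integral_const_mul, hwi, inv_mul_cancel₀ hpos.ne']
  have hw0' : ∀ᵐ x ∂leb, 0 ≤ c⁻¹ * w x := by
    filter_upwards [hw0] with x hx
    exact mul_nonneg (inv_nonneg.2 hpos.le) hx
  have hwP' : transfer S (fun x => c⁻¹ * w x) =ᵐ[leb] fun x => c⁻¹ * w x := by
    rw [h.transfer_const_mul]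
    filter_upwards [hwP] with x hx
    rw [hx]
  have hac := h.isAcip_withDensity (hwV.1.const_mul c⁻¹) hw0' hwi' hwP'
  have hνw := huniq _ hac
  have h1 : ν ν.support = 0 := by
    conv_lhs => rw [← hνw]
    rw [withDensity_apply_eq_ofReal (hwV.1.const_mul c⁻¹) hw0', hνw, integral_const_mul,
      hws _ hzero, mul_zero, ENNReal.ofReal_zero]
  have h2 : ν univ = 0 := by
    rw [← union_compl_self ν.support]
    exact measure_union_null h1 Measure.measure_compl_support
  have := hν.1
  rw [measure_univ] at h2
  exact one_ne_zero h2

theorem IsBranched.continuousAt_iterate (h : IsBranched S β) {n : ℕ} {x : ℝ}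
    (hx : x ∈ Icc (0 : ℝ) 1) (hβ : ∀ i < n, S^[i] x ∉ range β) : ContinuousAt (S^[n]) x := by
  induction n with
  | zero => exact continuousAt_id
  | succ n ih =>
    rw [Function.iterate_succ']
    obtain ⟨k, hk⟩ := h.partition.exists_mem_cell (h.mapsTo.iterate n hx) (hβ n n.lt_succ_self)
    exact ContinuousAt.comp (h.differentiable k _ hk).continuousAt
      (ih fun i hi => hβ i (hi.trans n.lt_succ_self))

theorem IsAcip.support_subset {ν : Measure ℝ} (hν : IsAcip S ν) : ν.support ⊆ Icc 0 1 :=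
  Measure.support_subset_of_isClosed isClosed_Icc (hν.2.1.ae_le ae_mem_Icc)

/-- A recurrent function of zero mean vanishes. Otherwise it is bounded away from zero, with
opposite signs, on two open sets `U₁` and `U₂` that meet the support. By mixing, at a large return
time `k`, mass of the positive part is transported from `U₁` into `U₂`; as positive and
negative parts do not cancel, `P^k g` takes positive values in `U₂`, although it is
uniformly close to `g` there. -/
theorem IsRecurrent.lOne_eq_zero (hα : 0 < α) (hA : 0 < A) (h : IsBranched S β)
    (hLY : HasLasotaYorke α A C r S) {ν : Measure ℝ} (hν : IsAcip S ν)
    (huniq : ∀ ν', IsAcip S ν' → ν' = ν) (hmix : TopMixingOn S (range β) ν.support)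
    {g : ℝ → ℝ} (hg : IsRecurrent α A S g) (hg0 : ∫ x, g x ∂leb = 0) : lOne g = 0 := by
  by_contra hne
  have hgpos : 0 < lOne g := lt_of_le_of_ne (lOne_nonneg g) (Ne.symm hne)
  have hp : Integrable (fun x => max (g x) 0) leb := hg.memV.1.pos_part
  have hn : Integrable (fun x => max (-g x) 0) leb := hg.memV.1.neg.pos_part
  have hsum : lOne g = ∫ x, max (g x) 0 ∂leb + ∫ x, max (-g x) 0 ∂leb := by
    rw [← integral_add hp hn]
    refine integral_congr_ae (Eventually.of_forall fun x => ?_)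
    rcases le_total 0 (g x) with h1 | h1
    · simp only [max_eq_left h1, max_eq_right (neg_nonpos.2 h1), add_zero, abs_of_nonneg h1]
    · simp only [max_eq_right h1, max_eq_left (neg_nonneg.2 h1), zero_add, abs_of_nonpos h1]
  have hdiff : ∫ x, g x ∂leb = ∫ x, max (g x) 0 ∂leb - ∫ x, max (-g x) 0 ∂leb := by
    rw [← integral_sub hp hn]
    refine integral_congr_ae (Eventually.of_forall fun x => ?_)
    rcases le_total 0 (g x) with h1 | h1
    · simp only [max_eq_left h1, max_eq_right (neg_nonpos.2 h1), sub_zero]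
    · simp only [max_eq_right h1, max_eq_left (neg_nonneg.2 h1), zero_sub, neg_neg]
  have hgn := hg.neg h hLY
  obtain ⟨x₁, ⟨hx₁, hgx₁⟩, hU₁⟩ := ((hg.exists_pos_on_support hα hA h hLY hν huniq
    (by linarith)).and_eventually (hg.memV.ae_exists_lower_bound hα hA)).exists
  obtain ⟨x₂, ⟨hx₂, hgx₂⟩, hU₂⟩ := ((hgn.exists_pos_on_support hα hA h hLY hν huniq
    (by linarith)).and_eventually (hgn.memV.ae_exists_lower_bound hα hA)).exists
  obtain ⟨U₁, hU₁o, hxU₁, c₁, hc₁, hgU₁⟩ := hU₁ hgx₁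
  obtain ⟨U₂, hU₂o, hxU₂, c₂, hc₂, hgU₂⟩ := hU₂ hgx₂
  obtain ⟨N, hN⟩ := hmix U₁ U₂ hU₁o hU₂o ⟨x₁, hxU₁, hx₁⟩ ⟨x₂, hxU₂, hx₂⟩
  obtain ⟨c, hc1, hc⟩ := exists_ae_abs_le_gbv hα hA
  have hcpos : 0 < c := by linarith
  obtain ⟨k, hk, hkη⟩ := hg.returns (c₂ / (2 * c)) (by positivity) N
  obtain ⟨x, ⟨hxU, hxK⟩, hxβ, hxV, -⟩ := hN k hk
  have hcont := h.continuousAt_iterate (hν.support_subset hxK) hxβ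
  have hG : U₁ ∩ S^[k] ⁻¹' U₂ ∈ 𝓝 x :=
    inter_mem (hU₁o.mem_nhds hxU) (hcont.preimage_mem_nhds (hU₂o.mem_nhds hxV))
  have hGpos : leb (U₁ ∩ S^[k] ⁻¹' U₂) ≠ 0 := fun h0 =>
    ((Measure.mem_support_iff_forall x).1 hxK _ hG).ne' (hν.2.1 h0)
  apply hGpos
  -- `P^k g⁺` vanishes on `U₂`
  have hind : ∀ x, |U₂.indicator (1 : ℝ → ℝ) x| ≤ 1 := fun x => by
    by_cases hx : x ∈ U₂ <;> simp [hx]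
  have hm : AEStronglyMeasurable (U₂.indicator (1 : ℝ → ℝ)) leb :=
    (measurable_one.indicator hU₂o.measurableSet).aestronglyMeasurable
  have hi := h.integrable_mul_comp_iterate k hp hm hind
  have hvan : ∫ x, (transfer S)^[k] (fun x => max (g x) 0) x * U₂.indicator 1 x ∂leb = 0 := by
    refine integral_eq_zero_of_ae ?_
    filter_upwards [hg.iterate_posPart h k, hc _ ((hLY.memV g hg.memV k).sub hg.memV), hgU₂]
      with z hz1 hz2 hz3
    by_cases hz : z ∈ U₂
    · have h1 : c * gbv α A (fun x => (transfer S)^[k] g x - g x) ≤ c * (c₂ / (2 * c)) :=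
        mul_le_mul_of_nonneg_left hkη hcpos.le
      have h2 : c * (c₂ / (2 * c)) = c₂ / 2 := by field_simp
      have h3 : (transfer S)^[k] g z ≤ 0 := by
        linarith [le_abs_self ((transfer S)^[k] g z - g z), hz3 hz]
      simp [hz1, max_eq_right h3]
    · simp [hz]
  rw [(h.iterate_transfer_mul k hi).2] at hvan
  have h0 := (integral_eq_zero_iff_of_nonneg (fun x => mul_nonneg (le_max_right _ _)
    (indicator_nonneg (fun _ _ => zero_le_one) _)) hi).1 hvan
  rw [measure_eq_zero_iff_ae_notMem]
  filter_upwards [h0, hgU₁] with y hy1 hy2 hy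
  have h1 : S^[k] y ∈ U₂ := hy.2
  have h2 := hy2 hy.1
  have h3 : max (g y) 0 * U₂.indicator (1 : ℝ → ℝ) (S^[k] y) = 0 := hy1
  rw [indicator_of_mem h1, Pi.one_apply, mul_one] at h3
  linarith [le_max_left (g y) 0]

theorem HasLasotaYorke.tendsto_lOne_iterate (hα : 0 < α) (hA : 0 < A) (h : IsBranched S β)
    (hLY : HasLasotaYorke α A C r S) {ν : Measure ℝ} (hν : IsAcip S ν)
    (huniq : ∀ ν', IsAcip S ν' → ν' = ν) (hmix : TopMixingOn S (range β) ν.support)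
    {f : ℝ → ℝ} (hf : MemV α A f) (hf0 : ∫ x, f x ∂leb = 0) :
    Tendsto (fun n => lOne ((transfer S)^[n] f)) atTop (𝓝 0) := by
  obtain ⟨g, hg, hgi, hlim⟩ := hLY.exists_recurrent hα hA h hf
  rwa [hg.lOne_eq_zero hα hA h hLY hν huniq hmix (hgi.trans hf0)] at hlim

/-- By compactness of the unit ball of `V_α` in `L¹`, the convergence is uniform. -/
theorem HasLasotaYorke.exists_uniform_lOne_le (hα : 0 < α) (hA : 0 < A) (h : IsBranched S β)
    (hLY : HasLasotaYorke α A C r S) {ν : Measure ℝ} (hν : IsAcip S ν)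
    (huniq : ∀ ν', IsAcip S ν' → ν' = ν) (hmix : TopMixingOn S (range β) ν.support)
    {η : ℝ} (hη : 0 < η) : ∃ N : ℕ, ∀ φ, MemV α A φ → ∫ x, φ x ∂leb = 0 →
      lOne ((transfer S)^[N] φ) ≤ η * gbv α A φ := by
  by_contra hcon
  push Not at hcon
  choose φ hφV hφ0 hφ using hcon
  have hgpos : ∀ n, 0 < gbv α A (φ n) := by
    intro n
    refine lt_of_le_of_ne (gbv_nonneg _ _ _) fun h0 => ?_
    have h1 := hφ n
    rw [← h0, mul_zero] at h1
    have h2 := (h.lOne_iterate_transfer_le n (hφV n).1).trans (hφV n).lOne_le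
    linarith
  set f : ℕ → ℝ → ℝ := fun n x => (gbv α A (φ n))⁻¹ * φ n x with hf
  have hfV : ∀ n, MemV α A (f n) := fun n => (hφV n).const_mul _
  have hfB : ∀ n, gbv α A (f n) ≤ 1 := fun n => by
    refine ((hφV n).gbv_const_mul_le _).trans ?_
    rw [abs_of_pos (inv_pos.2 (hgpos n)), inv_mul_cancel₀ (hgpos n).ne']
  have hf0 : ∀ n, ∫ x, f n x ∂leb = 0 := fun n => by
    rw [hf]
    beta_reduce
    rw [integral_const_mul, hφ0, mul_zero]
  have hfη : ∀ n, η ≤ lOne ((transfer S)^[n] (f n)) := by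
    intro n
    have e : lOne ((transfer S)^[n] (f n)) =
        (gbv α A (φ n))⁻¹ * lOne ((transfer S)^[n] (φ n)) := by
      rw [hf, h.iterate_transfer_const_mul]
      simp only [lOne, abs_mul, abs_of_pos (inv_pos.2 (hgpos n))]
      exact integral_const_mul _ _
    rw [e, le_inv_mul_iff₀ (hgpos n), mul_comm]
    exact (hφ n).le
  obtain ⟨g, hgV, -, hlim⟩ := exists_lOne_limit hα hA (hyperfilter ℕ) hfV hfB
  have hg0 : ∫ x, g x ∂leb = 0 := by
    have h1 : Tendsto (fun n => ∫ x, f n x ∂leb) (hyperfilter ℕ : Ultrafilter ℕ)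
        (𝓝 (∫ x, g x ∂leb)) := by
      rw [tendsto_iff_norm_sub_tendsto_zero]
      refine squeeze_zero (fun n => norm_nonneg _) (fun n => ?_) hlim
      rw [← integral_sub (hfV n).1 hgV.1]
      exact abs_integral_le_lOne _
    simp only [hf0] at h1
    exact tendsto_nhds_unique h1 tendsto_const_nhds
  have h1 := hlim.add ((hLY.tendsto_lOne_iterate hα hA h hν huniq hmix hgV hg0).mono_left
    Nat.hyperfilter_le_atTop)
  rw [add_zero] at h1
  refine absurd (ge_of_tendsto h1 (Eventually.of_forall fun n => ?_)) (not_le.2 hη)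
  have h2 := h.lOne_iterate_transfer_sub_le n (hfV n).1 hgV.1
  have h3 := (abs_le.1 (abs_lOne_sub_lOne_le (h.integrable_iterate_transfer n (hfV n).1)
    (h.integrable_iterate_transfer n hgV.1))).2
  linarith [hfη n]

end Mixing

/-! ### Dependence on the parameter -/

section Family

variable {α A : ℝ} {T : ℝ → ℝ → ℝ} {p : ℕ} {b : Fin (p + 1) → ℝ → ℝ} {μ : ℝ → Measure ℝ}

theorem IsExpandingFamily.isBranched (hT : IsExpandingFamily α T b μ) {a : ℝ}
    (ha : a ∈ Icc (0 : ℝ) 1) : IsBranched (T a) fun k => b k a where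
  partition := ⟨hT.break_strictMono a ha, hT.break_zero a ha, hT.break_last a ha⟩
  mapsTo := hT.mapsTo a ha
  differentiable k x hx := hT.differentiable a ha k x hx
  deriv_ne k x hx h0 := by
    obtain ⟨l, u, hl, -, hlu⟩ := hT.expanding
    have := (hlu a ha k x hx).1
    rw [h0, abs_zero] at this
    linarith

/-- Joint continuity of `(a, x) ↦ T_a x` at `a = 0`, off the partition points. -/
theorem IsExpandingFamily.tendsto_apply (hT : IsExpandingFamily α T b μ) {Y : ℝ → ℝ} {y : ℝ}
    (hy : y ∈ Icc (0 : ℝ) 1) (hyb : y ∉ breakSet b 0)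
    (hY : Tendsto Y (𝓝[Icc 0 1] 0) (𝓝 y)) :
    Tendsto (fun a => T a (Y a)) (𝓝[Icc 0 1] 0) (𝓝 (T 0 y)) := by
  have h0 : (0 : ℝ) ∈ Icc (0 : ℝ) 1 := ⟨le_rfl, zero_le_one⟩
  obtain ⟨k, hk⟩ := (hT.isBranched h0).partition.exists_mem_cell hy hyb
  obtain ⟨L, hL⟩ := hT.break_lipschitz
  obtain ⟨l, u, -, -, hlu⟩ := hT.expanding
  have hb : ∀ k, Tendsto (b k) (𝓝[Icc 0 1] 0) (𝓝 (b k 0)) := fun k =>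
    (hL k).continuousOn 0 h0
  have hTy : Tendsto (fun a => T a y) (𝓝[Icc 0 1] 0) (𝓝 (T 0 y)) := by
    obtain ⟨C, hC⟩ := hT.param_regular
    -- the set of parameters `{0}` suffices, since differentiability is relative to `[0,1]`
    have := (hC y hy {0} (singleton_subset_iff.2 h0) ordConnected_singleton
      (by rintro a rfl; exact hyb)).1 0 rfl
    exact this.continuousWithinAt
  have hdist : Tendsto (fun a => u * ‖Y a - y‖) (𝓝[Icc 0 1] 0) (𝓝 0) := by
    have := (tendsto_iff_norm_sub_tendsto_zero.1 hY).const_mul u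
    rwa [mul_zero] at this
  have hdiff : Tendsto (fun a => T a (Y a) - T a y) (𝓝[Icc 0 1] 0) (𝓝 0) := by
    refine squeeze_zero_norm' ?_ hdist
    filter_upwards [self_mem_nhdsWithin, (hb k.castSucc).eventually_lt_const hk.1,
      (hb k.succ).eventually_const_lt hk.2, (hb k.castSucc).eventually_lt hY hk.1,
      hY.eventually_lt (hb k.succ) hk.2] with a ha h1 h2 h3 h4
    exact (convex_Ioo (b k.castSucc a) (b k.succ a)).norm_image_sub_le_of_norm_deriv_le
      (fun x hx => hT.differentiable a ha k x hx) (fun x hx => (hlu a ha k x hx).2)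
      ⟨h1, h2⟩ ⟨h3, h4⟩
  simpa using hdiff.add hTy

theorem IsExpandingFamily.tendsto_iterate (hT : IsExpandingFamily α T b μ) {x : ℝ}
    (hx : x ∈ Icc (0 : ℝ) 1) (n : ℕ) (hxb : ∀ i < n, (T 0)^[i] x ∉ breakSet b 0) :
    Tendsto (fun a => (T a)^[n] x) (𝓝[Icc 0 1] 0) (𝓝 ((T 0)^[n] x)) := by
  induction n with
  | zero => exact tendsto_const_nhds
  | succ n ih =>
    simp only [Function.iterate_succ_apply']
    exact hT.tendsto_apply ((hT.mapsTo 0 ⟨le_rfl, zero_le_one⟩).iterate n hx)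
      (hxb n n.lt_succ_self) (ih fun i hi => hxb i (hi.trans n.lt_succ_self))

/-- For a fixed time and a fixed interval `I`, the sets of points that `T_a^n` and `T_0^n` map
into `I` differ by little when `a` is small. -/
theorem IsExpandingFamily.tendsto_integral_indicator (hT : IsExpandingFamily α T b μ) (n : ℕ)
    {q : ℕ} {β : Fin (q + 1) → ℝ} (hβ : IsPartition β) (k : Fin q) :
    Tendsto (fun a => ∫ x, |(cell β k).indicator (1 : ℝ → ℝ) ((T a)^[n] x) -
      (cell β k).indicator 1 ((T 0)^[n] x)| ∂leb) (𝓝[Icc 0 1] 0) (𝓝 0) := by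
  have h0 : (0 : ℝ) ∈ Icc (0 : ℝ) 1 := ⟨le_rfl, zero_le_one⟩
  have hB := hT.isBranched h0
  have hm : AEStronglyMeasurable ((cell β k).indicator (1 : ℝ → ℝ)) leb :=
    (measurable_one.indicator (measurableSet_cell β k)).aestronglyMeasurable
  have hind : ∀ x, |(cell β k).indicator (1 : ℝ → ℝ) x| ≤ 1 := fun x => by
    by_cases hx : x ∈ cell β k <;> simp [hx]
  have key : Tendsto (fun a => ∫ x, |(cell β k).indicator (1 : ℝ → ℝ) ((T a)^[n] x) -
      (cell β k).indicator 1 ((T 0)^[n] x)| ∂leb) (𝓝[Icc 0 1] 0) (𝓝 (∫ _x, (0 : ℝ) ∂leb)) := by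
    refine tendsto_integral_filter_of_dominated_convergence (fun _ => 2) ?_ ?_
      (integrable_const _) ?_
    · filter_upwards [self_mem_nhdsWithin] with a ha
      exact (((hT.isBranched ha).aestronglyMeasurable_comp_iterate n hm).sub
        (hB.aestronglyMeasurable_comp_iterate n hm)).norm
    · refine Eventually.of_forall fun a => Eventually.of_forall fun x => ?_
      rw [Real.norm_eq_abs, abs_abs]
      refine (abs_sub _ _).trans ?_
      linarith [hind ((T a)^[n] x), hind ((T 0)^[n] x)]
    · have h1 : ∀ᵐ x ∂leb, ∀ i : ℕ, (T 0)^[i] x ∉ breakSet b 0 := ae_all_iff.2 fun i =>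
        hB.ae_iterate i (measure_eq_zero_iff_ae_notMem.1 (leb_eq_zero_of_finite (finite_range _)))
      have h2 : ∀ᵐ x ∂leb, (T 0)^[n] x ∉ range β :=
        hB.ae_iterate n (measure_eq_zero_iff_ae_notMem.1 (leb_eq_zero_of_finite (finite_range _)))
      filter_upwards [h1, h2, ae_mem_Icc] with x hx1 hx2 hx
      obtain ⟨j, hj⟩ := hβ.exists_mem_cell (hB.mapsTo.iterate n hx) hx2
      have h3 := (hT.tendsto_iterate hx n fun i _ => hx1 i).eventually
        (isOpen_Ioo.mem_nhds hj)
      refine tendsto_const_nhds.congr' ?_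
      filter_upwards [h3] with a ha
      have ha' : (T a)^[n] x ∈ cell β j := ha
      rcases eq_or_ne j k with rfl | hjk
      · simp [hj, ha']
      · have h4 := Set.disjoint_left.1 (hβ.disjoint_cell hjk)
        simp [h4 hj, h4 ha']
  simpa using key

/-- The transfer operators depend continuously on the parameter, as operators from `V_α` to
`L¹`. -/
theorem IsExpandingFamily.eventually_lOne_sub_le (hα : 0 < α) (hA : 0 < A)
    (hT : IsExpandingFamily α T b μ) {ε C r : ℝ} (hε : 0 < ε) (hε1 : ε ≤ 1)
    (hLY : ∀ a ∈ Icc 0 ε, HasLasotaYorke α A C r (T a)) (n : ℕ) {η : ℝ} (hη : 0 < η) :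
    ∃ ε' : ℝ, 0 < ε' ∧ ε' ≤ ε ∧ ∀ a ∈ Icc 0 ε', ∀ φ, MemV α A φ →
      lOne (fun x => (transfer (T a))^[n] φ x - (transfer (T 0))^[n] φ x) ≤ η * gbv α A φ := by
  have h00 : (0 : ℝ) ∈ Icc (0 : ℝ) 1 := ⟨le_rfl, zero_le_one⟩
  have hB := hT.isBranched h00
  have hLY0 := hLY 0 ⟨le_rfl, hε.le⟩
  obtain ⟨c, hc1, hc⟩ := exists_ae_abs_le_gbv hα hA
  obtain ⟨M, hM, hMA, hMe⟩ : ∃ M : ℕ, 0 < M ∧ 1 / (M : ℝ) ≤ A ∧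
      (1 / (M : ℝ)) ^ α * (4 * C) < η / 2 := by
    have h1 : Tendsto (fun M : ℕ => (1 / (M : ℝ)) ^ α * (4 * C)) atTop (𝓝 (0 ^ α * (4 * C))) :=
      ((tendsto_one_div_atTop_nhds_zero_nat).rpow_const (Or.inr hα.le)).mul_const _
    rw [Real.zero_rpow hα.ne', zero_mul] at h1
    have h2 := h1.eventually_lt_const (half_pos hη)
    have h3 : ∀ᶠ M : ℕ in atTop, 1 / (M : ℝ) ≤ A :=
      (tendsto_one_div_atTop_nhds_zero_nat (𝕜 := ℝ)).eventually_le_const hA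
    obtain ⟨M, h4, h5, h6⟩ := ((eventually_gt_atTop 0).and (h3.and h2)).exists
    exact ⟨M, h4, h5, h6⟩
  have hP := isPartition_uniformPartition hM
  set I := cell (uniformPartition M) with hI
  set d : Fin M → ℝ → ℝ := fun k a => ∫ x, |(I k).indicator (1 : ℝ → ℝ) ((T a)^[n] x) -
      (I k).indicator 1 ((T 0)^[n] x)| ∂leb with hd
  have hlim : Tendsto (fun a => ∑ k, c * d k a) (𝓝[Icc 0 1] 0) (𝓝 (∑ _k : Fin M, c * 0)) :=
    tendsto_finsetSum _ fun k _ => (hT.tendsto_integral_indicator n hP k).const_mul c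
  simp only [mul_zero, Finset.sum_const_zero] at hlim
  obtain ⟨δ, hδ, hδs⟩ := Metric.mem_nhdsWithin_iff.1 (hlim.eventually_lt_const (half_pos hη))
  refine ⟨min (δ / 2) ε, lt_min (half_pos hδ) hε, min_le_right _ _, fun a ha φ hφ => ?_⟩
  have haε : a ∈ Icc 0 ε := ⟨ha.1, ha.2.trans (min_le_right _ _)⟩
  have ha1 : a ∈ Icc (0 : ℝ) 1 := ⟨ha.1, haε.2.trans hε1⟩
  have hBa := hT.isBranched ha1
  have hda : ∑ k, c * d k a < η / 2 := by
    refine hδs ⟨?_, ha1⟩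
    rw [Metric.mem_ball, Real.dist_eq, sub_zero, abs_of_nonneg ha.1]
    linarith [ha.2.trans (min_le_left _ _)]
  have hVa := (hLY a haε).memV φ hφ n
  have hV0 := hLY0.memV φ hφ n
  have hcell : ∀ k, |∫ x in I k, ((transfer (T a))^[n] φ x - (transfer (T 0))^[n] φ x)| ≤
      c * d k a * gbv α A φ := by
    intro k
    have hm : AEStronglyMeasurable ((I k).indicator (1 : ℝ → ℝ)) leb :=
      (measurable_one.indicator (measurableSet_cell _ k)).aestronglyMeasurable
    have hind : ∀ x, |(I k).indicator (1 : ℝ → ℝ) x| ≤ 1 := fun x => by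
      by_cases hx : x ∈ I k <;> simp [hx]
    have hia := hBa.integrable_mul_comp_iterate n hφ.1 hm hind
    have hi0 := hB.integrable_mul_comp_iterate n hφ.1 hm hind
    have e : ∀ w : ℝ → ℝ, ∫ x in I k, w x = ∫ x, w x * (I k).indicator 1 x ∂leb := by
      intro w
      rw [← hP.leb_restrict_cell k, ← integral_indicator (measurableSet_cell _ k)]
      refine integral_congr_ae (Eventually.of_forall fun x => ?_)
      by_cases hx : x ∈ I k
      · have hx' : x ∈ cell (uniformPartition M) k := hx
        simp [hx, hx']
      · have hx' : x ∉ cell (uniformPartition M) k := hx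
        simp [hx, hx']
    rw [integral_sub (hP.integrableOn_cell hVa.1 k) (hP.integrableOn_cell hV0.1 k), e, e,
      (hBa.iterate_transfer_mul n hia).2, (hB.iterate_transfer_mul n hi0).2,
      ← integral_sub hia hi0]
    have hdi : Integrable (fun x => |(I k).indicator (1 : ℝ → ℝ) ((T a)^[n] x) -
        (I k).indicator 1 ((T 0)^[n] x)|) leb := by
      have h1 := hBa.integrable_mul_comp_iterate n (integrable_const (1 : ℝ)) hm hind
      have h2 := hB.integrable_mul_comp_iterate n (integrable_const (1 : ℝ)) hm hind
      simp only [one_mul] at h1 h2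
      exact (h1.sub h2).abs
    calc _ ≤ ∫ x, |φ x * (I k).indicator 1 ((T a)^[n] x) -
          φ x * (I k).indicator 1 ((T 0)^[n] x)| ∂leb := abs_integral_le_integral_abs
      _ ≤ ∫ x, c * gbv α A φ * |(I k).indicator (1 : ℝ → ℝ) ((T a)^[n] x) -
          (I k).indicator 1 ((T 0)^[n] x)| ∂leb := by
          refine integral_mono_ae (hia.sub hi0).abs (hdi.const_mul _) ?_
          filter_upwards [hc φ hφ] with x hx
          rw [← mul_sub, abs_mul]
          exact mul_le_mul_of_nonneg_right hx (abs_nonneg _)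
      _ = c * d k a * gbv α A φ := by
          rw [integral_const_mul]
          ring
  have h1 := (hVa.sub hV0).lOne_le_sum hM hMA
  have h2 : ∑ k, |∫ x in I k, ((transfer (T a))^[n] φ x - (transfer (T 0))^[n] φ x)| ≤
      η / 2 * gbv α A φ := by
    refine (Finset.sum_le_sum fun k _ => hcell k).trans ?_
    rw [← Finset.sum_mul]
    exact mul_le_mul_of_nonneg_right hda.le (gbv_nonneg _ _ _)
  have h3 : (1 / (M : ℝ)) ^ α *
      gbv α A (fun x => (transfer (T a))^[n] φ x - (transfer (T 0))^[n] φ x) ≤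
      η / 2 * gbv α A φ := by
    have h4 := hVa.gbv_sub_le hV0
    have h5 := (hLY a haε).gbv_iterate_le hφ n
    have h6 := hLY0.gbv_iterate_le hφ n
    calc _ ≤ (1 / (M : ℝ)) ^ α * (4 * C * gbv α A φ) :=
          mul_le_mul_of_nonneg_left (by linarith) (Real.rpow_nonneg (by positivity) _)
      _ = (1 / (M : ℝ)) ^ α * (4 * C) * gbv α A φ := by ring
      _ ≤ _ := mul_le_mul_of_nonneg_right hMe.le (gbv_nonneg _ _ _)
  linarith

theorem ConditionII.exists_hasLasotaYorke (hT : IsExpandingFamily α T b μ) {ε : ℝ} (hε1 : ε ≤ 1)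
    (hII : ConditionII α A T b μ ε) :
    ∃ C r : ℝ, ∀ a ∈ Icc 0 ε, HasLasotaYorke α A C r (T a) := by
  obtain ⟨-, C, r, hC, hr, hr1, h⟩ := hII
  refine ⟨C, r, fun a ha => ?_⟩
  have hB := hT.isBranched ⟨ha.1, ha.2.trans hε1⟩
  have key : ∀ φ, MemV α A φ → ∀ n, 1 ≤ n → vNorm α A ((transfer (T a))^[n] φ) ≤
      ENNReal.ofReal (C * r ^ n * gbv α A φ + C * lOne φ) := by
    intro φ hφ n hn
    refine (h a ha φ hφ n hn).trans (le_of_eq ?_)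
    have h1 : 0 ≤ C * r ^ n := mul_nonneg (by linarith) (pow_nonneg hr.le _)
    rw [hφ.vNorm_eq, eLpNorm_eq_ofReal_lOne hφ.1, ← ENNReal.ofReal_mul h1,
      ← ENNReal.ofReal_mul (by linarith), ← ENNReal.ofReal_add
      (mul_nonneg h1 (gbv_nonneg _ _ _)) (mul_nonneg (by linarith) (lOne_nonneg _))]
  refine ⟨hC, hr, hr1, fun φ hφ n => ?_, fun φ hφ n => ?_⟩
  · rcases Nat.eq_zero_or_pos n with rfl | hn
    · exact hφ
    · exact ⟨hB.integrable_iterate_transfer n hφ.1,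
        (le_self_add.trans (key φ hφ n hn)).trans_lt ENNReal.ofReal_lt_top⟩
  · have h0 := gbv_nonneg α A φ
    have h1 : 0 ≤ C * lOne φ := mul_nonneg (by linarith) (lOne_nonneg _)
    rcases Nat.eq_zero_or_pos n with rfl | hn
    · rw [pow_zero, mul_one, Function.iterate_zero, id]
      nlinarith
    · refine (ENNReal.toReal_mono ENNReal.ofReal_ne_top (key φ hφ n hn)).trans (le_of_eq ?_)
      refine ENNReal.toReal_ofReal (add_nonneg (mul_nonneg ?_ h0) h1)
      exact mul_nonneg (by linarith) (pow_nonneg hr.le _)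

/-! ### Uniform exponential decay -/

/-- For small parameters a fixed power of the transfer operator contracts the functions of zero
mean in the norm of `V_α`. -/
theorem ConditionII.exists_contraction (hα : 0 < α) (hA : 0 < A)
    (hT : IsExpandingFamily α T b μ) {ε C r : ℝ} (hε : 0 < ε) (hε1 : ε ≤ 1)
    (hII : ConditionII α A T b μ ε) (hLY : ∀ a ∈ Icc 0 ε, HasLasotaYorke α A C r (T a)) :
    ∃ (ε' : ℝ) (Q : ℕ), 0 < ε' ∧ ε' ≤ ε ∧ 0 < Q ∧ ∀ a ∈ Icc 0 ε', ∀ φ, MemV α A φ →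
      ∫ x, φ x ∂leb = 0 → gbv α A ((transfer (T a))^[Q] φ) ≤ 1 / 2 * gbv α A φ := by
  have h00 : (0 : ℝ) ∈ Icc (0 : ℝ) 1 := ⟨le_rfl, zero_le_one⟩
  have hLY0 := hLY 0 ⟨le_rfl, hε.le⟩
  have hC := hLY0.one_le
  have hη : 0 < 1 / (8 * C) := by positivity
  obtain ⟨N, hN⟩ := hLY0.exists_uniform_lOne_le hα hA (hT.isBranched h00) (hT.acip 0 h00)
    (hT.acip_unique 0 h00) hII.1 hη
  obtain ⟨ε', hε'0, hε', hstab⟩ := hT.eventually_lOne_sub_le hα hA hε hε1 hLY N hη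
  obtain ⟨m, hm⟩ : ∃ m : ℕ, C * r ^ (m + 1) * (2 * C) < 1 / 4 := by
    have h1 : Tendsto (fun m : ℕ => C * r ^ (m + 1) * (2 * C)) atTop (𝓝 (C * 0 * (2 * C))) :=
      (((tendsto_pow_atTop_nhds_zero_of_lt_one hLY0.pos.le hLY0.lt_one).comp
        (tendsto_add_atTop_nat 1)).const_mul C).mul_const _
    rw [mul_zero, zero_mul] at h1
    exact (h1.eventually_lt_const (by norm_num)).exists
  refine ⟨ε', m + 1 + N, hε'0, hε', by omega, fun a ha φ hφ hφ0 => ?_⟩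
  have haε : a ∈ Icc 0 ε := ⟨ha.1, ha.2.trans hε'⟩
  have hV := (hLY a haε).memV φ hφ N
  have h1 := (hLY a haε).bound _ hV (m + 1)
  rw [← Function.iterate_add_apply] at h1
  have h2 := (hLY a haε).gbv_iterate_le hφ N
  have h3 := hN φ hφ hφ0
  have h4 := hstab a ha φ hφ
  have h5 := (abs_le.1 (abs_lOne_sub_lOne_le hV.1 (hLY0.memV φ hφ N).1)).2
  have h6 : C * r ^ (m + 1) * gbv α A ((transfer (T a))^[N] φ) ≤ 1 / 4 * gbv α A φ := by
    calc _ ≤ C * r ^ (m + 1) * (2 * C * gbv α A φ) :=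
          mul_le_mul_of_nonneg_left h2 (mul_nonneg (by linarith) (pow_nonneg hLY0.pos.le _))
      _ = C * r ^ (m + 1) * (2 * C) * gbv α A φ := by ring
      _ ≤ _ := mul_le_mul_of_nonneg_right hm.le (gbv_nonneg _ _ _)
  have h7 : C * lOne ((transfer (T a))^[N] φ) ≤ C * (2 * (1 / (8 * C)) * gbv α A φ) :=
    mul_le_mul_of_nonneg_left (by linarith) (by linarith)
  have h8 : C * (2 * (1 / (8 * C)) * gbv α A φ) = 1 / 4 * gbv α A φ := by
    field_simp
    ring
  linarith

theorem HasLasotaYorke.gbv_iterate_le_pow {S : ℝ → ℝ} {β : Fin (p + 1) → ℝ} {C r : ℝ}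
    (h : IsBranched S β) (hLY : HasLasotaYorke α A C r S) {Q : ℕ} (hQ : 0 < Q)
    (hcontr : ∀ φ, MemV α A φ → ∫ x, φ x ∂leb = 0 →
      gbv α A ((transfer S)^[Q] φ) ≤ 1 / 2 * gbv α A φ)
    {ρ : ℝ} (hρ0 : 0 < ρ) (hρ1 : ρ < 1) (hρ : ρ ^ Q = 1 / 2) {φ : ℝ → ℝ} (hφ : MemV α A φ)
    (hφ0 : ∫ x, φ x ∂leb = 0) (n : ℕ) :
    gbv α A ((transfer S)^[n] φ) ≤ 4 * C * ρ ^ n * gbv α A φ := by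
  have hC := hLY.one_le
  have hg := gbv_nonneg α A φ
  have hblock : ∀ q : ℕ, gbv α A ((transfer S)^[Q * q] φ) ≤ (1 / 2) ^ q * gbv α A φ := by
    intro q
    induction q with
    | zero => simp
    | succ q ih =>
      rw [Nat.mul_succ, add_comm, Function.iterate_add_apply]
      have h1 := hcontr _ (hLY.memV φ hφ (Q * q))
        ((h.integral_iterate_transfer (Q * q) hφ.1).trans hφ0)
      rw [pow_succ]
      linarith
  have h1 := hLY.gbv_iterate_le (hLY.memV φ hφ (Q * (n / Q))) (n % Q)
  rw [← Function.iterate_add_apply, Nat.mod_add_div] at h1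
  have h2 : (1 / 2 : ℝ) ^ (n / Q) ≤ 2 * ρ ^ n := by
    have h3 : ρ ^ Q ≤ ρ ^ (n % Q) :=
      pow_le_pow_of_le_one hρ0.le hρ1.le (Nat.mod_lt n hQ).le
    have h4 : ρ ^ n = (1 / 2) ^ (n / Q) * ρ ^ (n % Q) := by
      rw [← hρ, ← pow_mul, ← pow_add, Nat.div_add_mod]
    rw [h4]
    rw [hρ] at h3
    nlinarith [show (0 : ℝ) < (1 / 2) ^ (n / Q) by positivity]
  calc _ ≤ 2 * C * gbv α A ((transfer S)^[Q * (n / Q)] φ) := h1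
    _ ≤ 2 * C * ((1 / 2) ^ (n / Q) * gbv α A φ) :=
        mul_le_mul_of_nonneg_left (hblock _) (by linarith)
    _ ≤ 2 * C * (2 * ρ ^ n * gbv α A φ) := by gcongr
    _ = _ := by ring

/-- Decay of correlations for a single map whose transfer operator contracts the functions of zero
mean. The function `φ - (∫ φ) w`, with `w` the invariant density, has zero mean, and its image
under the iterates of the transfer operator is uniformly small since `V_α` embeds into `L^∞`. -/
theorem HasLasotaYorke.decay_of_correlations (hα : 0 < α) (hA : 0 < A) {S : ℝ → ℝ}
    {β : Fin (p + 1) → ℝ} {C r : ℝ} (h : IsBranched S β) (hLY : HasLasotaYorke α A C r S)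
    {ν : Measure ℝ} (huniq : ∀ ν', IsAcip S ν' → ν' = ν) {K ρ : ℝ}
    (hdecay : ∀ φ, MemV α A φ → ∫ x, φ x ∂leb = 0 → ∀ n,
      gbv α A ((transfer S)^[n] φ) ≤ K * ρ ^ n * gbv α A φ) (hK : 0 ≤ K) (hρ : 0 ≤ ρ)
    {c : ℝ} (hc0 : 0 ≤ c) (hc : ∀ φ, MemV α A φ → ∀ᵐ y ∂leb, |φ y| ≤ c * gbv α A φ)
    {φ ψ : ℝ → ℝ} (hφ : MemV α A φ) (hψ : Integrable ψ leb) (n : ℕ) :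
    Integrable (fun x => φ x * ψ (S^[n] x)) leb ∧ Integrable ψ ν ∧
      |(∫ x, φ x * ψ (S^[n] x) ∂leb) - (∫ x, φ x ∂leb) * ∫ x, ψ x ∂ν| ≤
        c * (K * (1 + 4 * C)) * gbv α A φ * (∫ x, |ψ x| ∂leb) * ρ ^ n := by
  have hC := hLY.one_le
  -- in `V_α`, hence bounded, hence integrable against `ψ`
  have hmul : ∀ f, MemV α A f → Integrable (fun x => f x * ψ x) leb := fun f hf =>
    hψ.bdd_mul (c := c * gbv α A f) hf.1.1 (hc f hf)
  have hint : Integrable (fun x => φ x * ψ (S^[n] x)) leb := by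
    have h1 := h.integrable_of_iterate_transfer_mul n hφ.1.abs (fun x => abs_nonneg _) hψ.1
      (hmul _ (hLY.memV _ hφ.abs n))
    exact h1.mono (hφ.1.1.mul (h.aestronglyMeasurable_comp_iterate n hψ.1))
      (Eventually.of_forall fun x => by simp)
  obtain ⟨w, hwV, hwB, hw0, hwP, hwi, -⟩ := hLY.exists_invariant hα hA h (MemV.const α A 1)
    fun _ => zero_le_one
  rw [gbv_const, abs_one, mul_one] at hwB
  have hwi1 : ∫ x, w x ∂leb = 1 := by simpa using hwi
  have hν := huniq _ (h.isAcip_withDensity hwV.1 hw0 hwi1 hwP)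
  have hwm : AEMeasurable (fun x => Real.toNNReal (w x)) leb := hwV.1.1.aemeasurable.real_toNNReal
  have hsm : (fun x => Real.toNNReal (w x) • ψ x) =ᵐ[leb] fun x => w x * ψ x := by
    filter_upwards [hw0] with x hx
    rw [NNReal.smul_def, Real.coe_toNNReal _ hx, smul_eq_mul]
  have hψν : Integrable ψ ν := by
    rw [← hν]
    exact (integrable_withDensity_iff_integrable_smul₀ hwm).2 ((hmul w hwV).congr hsm.symm)
  have hψi : ∫ x, ψ x ∂ν = ∫ x, w x * ψ x ∂leb := by
    rw [← hν]
    exact (integral_withDensity_eq_integral_smul₀ hwm ψ).trans (integral_congr_ae hsm)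
  refine ⟨hint, hψν, ?_⟩
  set a := ∫ x, φ x ∂leb with ha
  have hVd : MemV α A fun x => φ x - a * w x := hφ.sub (hwV.const_mul a)
  have hd0 : ∫ x, (φ x - a * w x) ∂leb = 0 := by
    rw [integral_sub hφ.1 (hwV.1.const_mul a), integral_const_mul, hwi1, mul_one, sub_self]
  have hwn : (transfer S)^[n] w =ᵐ[leb] w := by
    clear hint
    induction n with
    | zero => rfl
    | succ n ih =>
      rw [Function.iterate_succ_apply]
      exact (h.iterate_transfer_congr n (h.integrable_iterate_transfer 1 hwV.1) hwP).trans ih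
  have hgd : gbv α A (fun x => φ x - a * w x) ≤ (1 + 4 * C) * gbv α A φ := by
    have h1 := hφ.gbv_sub_le (hwV.const_mul a)
    have h2 := hwV.gbv_const_mul_le a
    have h3 : |a| ≤ gbv α A φ := (abs_integral_le_lOne φ).trans hφ.lOne_le
    have h4 : |a| * gbv α A w ≤ gbv α A φ * (4 * C) :=
      mul_le_mul h3 hwB (gbv_nonneg _ _ _) (gbv_nonneg _ _ _)
    linarith
  have hPn := hLY.memV _ hVd n
  have e : (∫ x, φ x * ψ (S^[n] x) ∂leb) - a * ∫ x, ψ x ∂ν =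
      ∫ x, (transfer S)^[n] (fun x => φ x - a * w x) x * ψ x ∂leb := by
    rw [hψi, ← (h.iterate_transfer_mul n hint).2, ← integral_const_mul,
      ← integral_sub (h.iterate_transfer_mul n hint).1 ((hmul w hwV).const_mul a)]
    refine integral_congr_ae ?_
    rw [h.iterate_transfer_sub, h.iterate_transfer_const_mul]
    filter_upwards [hwn] with x hx
    rw [hx]
    ring
  rw [e]
  calc _ ≤ ∫ x, |(transfer S)^[n] (fun x => φ x - a * w x) x * ψ x| ∂leb :=
        abs_integral_le_integral_abs
    _ ≤ ∫ x, c * (K * ρ ^ n * ((1 + 4 * C) * gbv α A φ)) * |ψ x| ∂leb := by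
        refine integral_mono_ae (hmul _ hPn).abs (hψ.abs.const_mul _) ?_
        filter_upwards [hc _ hPn] with x hx
        rw [abs_mul]
        refine mul_le_mul_of_nonneg_right (hx.trans (mul_le_mul_of_nonneg_left ?_ hc0))
          (abs_nonneg _)
        exact (hdecay _ hVd hd0 n).trans
          (mul_le_mul_of_nonneg_left hgd (mul_nonneg hK (pow_nonneg hρ _)))
    _ = _ := by
        rw [integral_const_mul]
        ring

end Family

end UDC

theorem proposition4p3 (α A : ℝ) (hα : 0 < α) (hα1 : α ≤ 1) (hA : 0 < A)
    (T : ℝ → ℝ → ℝ) (p : ℕ) (b : Fin (p + 1) → ℝ → ℝ) (μ : ℝ → MeasureTheory.Measure ℝ)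
    (hT : UDC.IsExpandingFamily α T b μ)
    (ε : ℝ) (hε : 0 < ε) (hε1 : ε ≤ 1) (hII : UDC.ConditionII α A T b μ ε) :
    ∃ ε' C ρ : ℝ, 0 < ε' ∧ ε' ≤ ε ∧ 1 ≤ C ∧ 0 < ρ ∧ ρ < 1 ∧
      ∀ a ∈ Set.Icc (0 : ℝ) ε', ∀ φ : ℝ → ℝ, UDC.MemV α A φ →
        ∀ ψ : ℝ → ℝ, MeasureTheory.Integrable ψ UDC.leb → ∀ n : ℕ, 1 ≤ n →
          MeasureTheory.Integrable (fun x => φ x * ψ ((T a)^[n] x)) UDC.leb ∧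
          MeasureTheory.Integrable ψ (μ a) ∧
          |(∫ x, φ x * ψ ((T a)^[n] x) ∂UDC.leb) -
              (∫ x, φ x ∂UDC.leb) * ∫ x, ψ x ∂(μ a)|
            ≤ C * (UDC.vNorm α A φ).toReal * (∫ x, |ψ x| ∂UDC.leb) * ρ ^ n := by
  obtain ⟨C, r, hLY⟩ := hII.exists_hasLasotaYorke hT hε1
  obtain ⟨ε', Q, hε'0, hε', hQ, hcontr⟩ := hII.exists_contraction hα hA hT hε hε1 hLY
  obtain ⟨c, hc1, hc⟩ := UDC.exists_ae_abs_le_gbv hα hA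
  have hC := (hLY 0 ⟨le_rfl, hε.le⟩).one_le
  have hQ' : (0 : ℝ) < Q := by exact_mod_cast hQ
  set ρ : ℝ := (1 / 2 : ℝ) ^ (1 / (Q : ℝ)) with hρdef
  have hρ0 : 0 < ρ := Real.rpow_pos_of_pos (by norm_num) _
  have hρ1 : ρ < 1 := Real.rpow_lt_one (by norm_num) (by norm_num) (by positivity)
  have hρ : ρ ^ Q = 1 / 2 := by
    rw [hρdef, one_div (Q : ℝ), Real.rpow_inv_natCast_pow (by norm_num) hQ.ne']
  refine ⟨ε', c * (4 * C * (1 + 4 * C)), ρ, hε'0, hε', ?_, hρ0, hρ1, ?_⟩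
  · have h1 : 1 ≤ 4 * C * (1 + 4 * C) := by nlinarith
    nlinarith
  · intro a ha φ hφ ψ hψ n _
    have haε : a ∈ Set.Icc 0 ε := ⟨ha.1, ha.2.trans hε'⟩
    have ha1 : a ∈ Set.Icc (0 : ℝ) 1 := ⟨ha.1, haε.2.trans hε1⟩
    exact (hLY a haε).decay_of_correlations hα hA (hT.isBranched ha1) (hT.acip_unique a ha1)
      (fun φ hφ hφ0 n => (hLY a haε).gbv_iterate_le_pow (hT.isBranched ha1) hQ (hcontr a ha)
        hρ0 hρ1 hρ hφ hφ0 n) (by linarith) hρ0.le (by linarith) hc hφ hψ n
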